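/- Setting. Let $L$ be a countable, possibly many-sorted first-order language (countably many sorts and symbols), let $\mathfrak C$ be an infinite $L$-structure and $\kappa>2^{\aleph_0}$ a cardinal such that $\mathfrak C$ is $\kappa$-saturated and strongly $\kappa$-homogeneous (a monster model of its complete theory). Small means of cardinality less than $\kappa$. Models are elementary substructures of $\mathfrak C$; invariant means invariant under $\mathrm{Aut}(\mathfrak C)$, and type-definable means type-definable without parameters. Let $P$ be a product of countably many sorts and write $a\equiv b$ if $\mathrm{tp}(a/\emptyset)=\mathrm{tp}(b/\emptyset)$. A subset of $P$ is pseudo-closed if it is type-definable over some small set of parameters. Let $X\subseteq P$ be type-definable and let $E$ be an invariant equivalence relation on $X$ which is - bounded: it has fewer than $\kappa$ classes; - $F_\sigma$: the set $\{\mathrm{tp}(a,b/\emptyset) : a\mathrel E b\}$ is an $F_\sigma$ subset of the space of complete types $S_{P^2}(\emptyset)$; - orbital on types: $E\subseteq{\equiv}$, and for every complete type $p$ over $\emptyset$ there is a group $\Gamma_p\le \mathrm{Aut}(\mathfrak C)$ which preserves setwise every class of the restriction of $E$ to the realisations of $p$ in $X$, and acts transitively on each of these classes. Let $(\Phi_n(x,y))_{n\in\mathbb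 N}$ be any normal form for $E$, i.e. a sequence of partial types over $\emptyset$ such that $\Phi_0(x,y)$ is equivalent to $x=y\wedge x\in X$, $\Phi_n\vdash\Phi_{n+1}$ for all $n$, for all $a,b\in X$ one has $a\mathrel E b$ if and only if $\Phi_n(a,b)$ holds for some $n$, and $d(a,b)=\min\{n : \ \models\Phi_n(a,b)\}$ (with $\min\emptyset=\infty$) is a metric on $X$ with values in $\mathbb N\cup\{\infty\}$. Diameters are taken with respect to $d$. For a countable model $M$ and $Y\subseteq X$ put $Y_M=\{\mathrm{tp}(y/M) : y\in Y\}$, with the topology induced from the space of types over $M$, and let $p\mathrel{E^M}q$ mean that $a\mathrel E b$ for some $a\models p$, $b\models q$. The restriction $E\restriction_Y$ is called smooth if, for some countable model $M$, the relation $E^M\restriction_{Y_M}$ is smooth, i.e. there are a Polish space $Z$ and a Borel map $f\colon Y_M\to Z$ such that $p\mathrel{E^M}q\iff f(p)=f(q)$ for all $p,q\in Y_M$. Statement. Let $a\in X$ and let $Y\subseteq[a]_\equiv$ be a pseudo-closed set with $a\in Y$ which is $E$-saturated (it contains every $E$-class that it meets). Then the following are equivalent: 1. $E\restriction_Y$ is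 smooth (equivalently, $E^M\restriction_{Y_M}$ is smooth for every countable model $M$); 2. $E\restriction_{[a]_\equiv}$ is type-definable; 3. all $E$-classes in $[a]_\equiv$ have finite diameter; 4. all $E$-classes in $[a]_\equiv$ are pseudo-closed; 5. $[a]_E$ has finite diameter; 6. $[a]_E$ is pseudo-closed. -/

import Mathlib

universe u v w

namespace ManySorted

/-! ### Many-sorted first-order logic -/

/-- A many-sorted first-order language: sorts, function symbols (with the list of the sorts of
their arguments and the sort of their value; constants are the case of the empty list), and
relation symbols (with the list of the sorts of their arguments). -/
structure SortedLanguage where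
  Sorts : Type u
  Func : List Sorts → Sorts → Type u
  Rel : List Sorts → Type u

/-- The language is countable: countably many sorts, function symbols and relation symbols. -/
class SortedLanguage.IsCountable (L : SortedLanguage.{u}) : Prop where
  sorts : Countable L.Sorts
  func : ∀ a s, Countable (L.Func a s)
  rel : ∀ a, Countable (L.Rel a)

/-- An `L`-structure on a family of carriers, one for each sort. -/
class SortedStructure (L : SortedLanguage.{u}) (M : L.Sorts → Type u) where
  funMap : ∀ {a : List L.Sorts} {s : L.Sorts}, L.Func a s →
    (∀ i : Fin a.length, M (a.get i)) → M s
  relMap : ∀ {a : List L.Sorts}, L.Rel a → (∀ i : Fin a.length, M (a.get i)) → Prop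

variable {L : SortedLanguage.{u}}

/-- Terms whose variables are indexed by `V`, the variable `i` being of sort `σ i`. -/
inductive Term {V : Type v} (σ : V → L.Sorts) : L.Sorts → Type (max u v)
  | var (i : V) : Term σ (σ i)
  | func {a : List L.Sorts} {s : L.Sorts} (f : L.Func a s)
      (ts : ∀ i : Fin a.length, Term σ (a.get i)) : Term σ s

/-- Formulas with free variables indexed by `V` (the variable `i` being of sort `σ i`) and with
further de Bruijn variables, not bound yet, whose sorts are listed in `l`. The quantifier binds
the first of the listed variables. -/
inductive BFormula {V : Type v} (σ : V → L.Sorts) : List L.Sorts → Type (max u v)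
  | falsum {l : List L.Sorts} : BFormula σ l
  | equal {l : List L.Sorts} {s : L.Sorts} (t₁ t₂ : Term (Sum.elim σ l.get) s) : BFormula σ l
  | rel {l : List L.Sorts} {a : List L.Sorts} (R : L.Rel a)
      (ts : ∀ i : Fin a.length, Term (Sum.elim σ l.get) (a.get i)) : BFormula σ l
  | imp {l : List L.Sorts} (φ ψ : BFormula σ l) : BFormula σ l
  | all {l : List L.Sorts} {s : L.Sorts} (φ : BFormula σ (s :: l)) : BFormula σ l

/-- Formulas with free variables indexed by `V`. -/
abbrev Formula {V : Type v} (σ : V → L.Sorts) : Type (max u v) := BFormula σ []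

/-- The product of sorts given by `σ`: tuples of elements of the structure of sorts `σ`. -/
abbrev Tuple (M : L.Sorts → Type u) {V : Type v} (σ : V → L.Sorts) : Type (max u v) :=
  ∀ i : V, M (σ i)

section Semantics

variable {M : L.Sorts → Type u}

/-- Concatenation of two tuples. -/
def join {V : Type v} {W : Type w} {σ : V → L.Sorts} {τ : W → L.Sorts}
    (x : Tuple M σ) (y : Tuple M τ) : Tuple M (Sum.elim σ τ)
  | Sum.inl i => x i
  | Sum.inr j => y j

/-- The tuple `y` with the element `m` put in front of it. -/
def consTuple {s : L.Sorts} {l : List L.Sorts} (m : M s) (y : Tuple M l.get) :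
    Tuple M (s :: l).get :=
  fun i => Fin.cases (motive := fun i => M ((s :: l).get i)) m y i

variable [SortedStructure L M]

/-- The value of a term. -/
def Term.eval {V : Type v} {σ : V → L.Sorts} (x : Tuple M σ) :
    ∀ {s : L.Sorts}, Term σ s → M s
  | _, .var i => x i
  | _, .func f ts => SortedStructure.funMap f (fun i => (ts i).eval x)

/-- Satisfaction of formulas (Tarski's truth definition). -/
def BFormula.Holds {V : Type v} {σ : V → L.Sorts} (x : Tuple M σ) :
    ∀ {l : List L.Sorts}, BFormula σ l → Tuple M l.get → Prop
  | _, .falsum, _ => False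
  | _, .equal t₁ t₂, y => t₁.eval (join x y) = t₂.eval (join x y)
  | _, .rel R ts, y => SortedStructure.relMap R (fun i => (ts i).eval (join x y))
  | _, .imp φ ψ, y => φ.Holds x y → ψ.Holds x y
  | _, .all (s := s) φ, y => ∀ m : M s, φ.Holds x (consTuple m y)

/-- The tuple `x` satisfies the formula `φ`. -/
def Formula.Realize {V : Type v} {σ : V → L.Sorts} (φ : Formula σ) (x : Tuple M σ) : Prop :=
  BFormula.Holds x φ (fun i => i.elim0)

end Semantics

/-- Families of permutations of the sorts. -/
abbrev SortPerm (M : L.Sorts → Type u) : Type u := ∀ s : L.Sorts, Equiv.Perm (M s)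

/-- The automorphism group of the structure `M`. -/
def Aut (M : L.Sorts → Type u) [SortedStructure L M] : Subgroup (SortPerm M) where
  carrier := {g |
    (∀ (a : List L.Sorts) (s : L.Sorts) (f : L.Func a s) (x : Tuple M a.get),
      g s (SortedStructure.funMap f x) = SortedStructure.funMap f (fun i => g _ (x i))) ∧
    (∀ (a : List L.Sorts) (R : L.Rel a) (x : Tuple M a.get),
      SortedStructure.relMap R (fun i => g _ (x i)) ↔ SortedStructure.relMap R x)}
  one_mem' := ⟨fun _ _ _ _ => rfl, fun _ _ _ => Iff.rfl⟩
  mul_mem' := by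
    rintro g h ⟨hg₁, hg₂⟩ ⟨hh₁, hh₂⟩
    refine ⟨fun a s f x => ?_, fun a R x => ?_⟩
    · show g s (h s _) = _
      rw [hh₁, hg₁]
      rfl
    · exact (hg₂ a R (fun i => h _ (x i))).trans (hh₂ a R x)
  inv_mem' := by
    rintro g ⟨hg₁, hg₂⟩
    refine ⟨fun a s f x => ?_, fun a R x => ?_⟩
    · show (g s).symm _ = SortedStructure.funMap f (fun i => (g _).symm (x i))
      rw [Equiv.symm_apply_eq, hg₁]
      simp
    · show SortedStructure.relMap R (fun i => (g _).symm (x i)) ↔ _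
      rw [← hg₂]
      simp

/-- The coordinatewise action of families of permutations on tuples. -/
def act {M : L.Sorts → Type u} {V : Type v} {σ : V → L.Sorts} (g : SortPerm M)
    (x : Tuple M σ) : Tuple M σ :=
  fun i => g (σ i) (x i)

/-! ### Parameters, types and type spaces -/

section Parameters

variable {M : L.Sorts → Type u}

/-- A set of parameters: a set of elements of the structure, of any sorts. -/
abbrev Params (M : L.Sorts → Type u) : Type u := Set (Σ s : L.Sorts, M s)

/-- Formulas in the variables `σ` with parameters from `A`: the parameters are plugged into
additional free variables, one for each element of `A`. -/
abbrev ParamFormula (A : Params M) {V : Type v} (σ : V → L.Sorts) : Type (max u v) :=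
  Formula (Sum.elim σ (fun c : A => c.1.1))

variable [SortedStructure L M]

/-- The tuple `x` satisfies the formula `φ` with parameters from `A`. -/
def Sat {A : Params M} {V : Type v} {σ : V → L.Sorts} (x : Tuple M σ)
    (φ : ParamFormula A σ) : Prop :=
  Formula.Realize φ (join x (fun c : A => c.1.2))

/-- The complete type of a tuple over `A`. -/
def tp (A : Params M) {V : Type v} {σ : V → L.Sorts} (x : Tuple M σ) : Set (ParamFormula A σ) :=
  {φ | Sat x φ}

/-- The space of complete types over `A` in the product of sorts `σ`, as the set of types of
tuples of `M` (for small `A` and a monster model `M`, every complete type is of this form). -/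
def TypeSpace (A : Params M) {V : Type v} (σ : V → L.Sorts) : Type (max u v) :=
  {p : Set (ParamFormula A σ) // ∃ x : Tuple M σ, tp A x = p}

/-- The usual topology on the type space, with basic open sets `[φ] = {p | φ ∈ p}`. -/
instance (A : Params M) {V : Type v} (σ : V → L.Sorts) : TopologicalSpace (TypeSpace A σ) :=
  TopologicalSpace.generateFrom
    {U | ∃ φ : ParamFormula A σ, U = {p : TypeSpace A σ | φ ∈ p.1}}

/-- The set of types over `A` of the elements of `D`. -/
def typesOf (A : Params M) {V : Type v} {σ : V → L.Sorts} (D : Set (Tuple M σ)) :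
    Set (TypeSpace A σ) :=
  {p | ∃ x ∈ D, tp A x = p.1}

/-- The set of realisations of the complete `∅`-type of `x`, i.e. the class of `x` with respect
to the relation of having the same type over `∅`. -/
def typeClass {V : Type v} {σ : V → L.Sorts} (x : Tuple M σ) : Set (Tuple M σ) :=
  {y | tp ∅ y = tp ∅ x}

/-- `D` is type-definable with parameters from `A`. -/
def IsTypeDefinable (A : Params M) {V : Type v} {σ : V → L.Sorts} (D : Set (Tuple M σ)) : Prop :=
  ∃ p : Set (ParamFormula A σ), D = {x | ∀ φ ∈ p, Sat x φ}

/-- `D` is pseudo-closed: type-definable over some small set of parameters, where small means of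
cardinality less than `κ`. -/
def IsPseudoClosed (κ : Cardinal.{u}) {V : Type v} {σ : V → L.Sorts}
    (D : Set (Tuple M σ)) : Prop :=
  ∃ A : Params M, Cardinal.mk A < κ ∧ IsTypeDefinable A D

/-- `κ`-saturation: every set of formulas in fewer than `κ` variables, with parameters from a set
of cardinality less than `κ`, that is finitely satisfiable in `M` is satisfied in `M`. -/
def IsSaturated (L : SortedLanguage.{u}) (M : L.Sorts → Type u) [SortedStructure L M]
    (κ : Cardinal.{u}) : Prop :=
  ∀ (V : Type u) (σ : V → L.Sorts) (A : Params M), Cardinal.mk V < κ → Cardinal.mk A < κ →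
    ∀ p : Set (ParamFormula A σ),
      (∀ q : Set (ParamFormula A σ), q.Finite → q ⊆ p → ∃ x : Tuple M σ, ∀ φ ∈ q, Sat x φ) →
      ∃ x : Tuple M σ, ∀ φ ∈ p, Sat x φ

/-- Strong `κ`-homogeneity: two tuples of length less than `κ` with the same type over `∅` are
conjugate under an automorphism. -/
def IsStronglyHomogeneous (L : SortedLanguage.{u}) (M : L.Sorts → Type u) [SortedStructure L M]
    (κ : Cardinal.{u}) : Prop :=
  ∀ (V : Type u) (σ : V → L.Sorts), Cardinal.mk V < κ →
    ∀ x y : Tuple M σ, tp ∅ x = tp ∅ y → ∃ g ∈ Aut M, act g x = y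

/-- `M` is a monster model (of its complete theory) with respect to `κ`. -/
structure IsMonster (L : SortedLanguage.{u}) (M : L.Sorts → Type u) [SortedStructure L M]
    (κ : Cardinal.{u}) : Prop where
  saturated : IsSaturated L M κ
  homogeneous : IsStronglyHomogeneous L M κ

/-! ### Elementary substructures -/

/-- The carriers of the family of subsets of the sorts given by `N`. -/
abbrev carrier (N : Params M) (s : L.Sorts) : Type u := {x : M s // (⟨s, x⟩ : Σ s, M s) ∈ N}

/-- `N` is closed under the functions of the structure. -/
def IsFuncClosed (N : Params M) : Prop :=
  ∀ (a : List L.Sorts) (s : L.Sorts) (f : L.Func a s) (x : Tuple M a.get),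
    (∀ i, (⟨_, x i⟩ : Σ s, M s) ∈ N) →
      (⟨s, SortedStructure.funMap f x⟩ : Σ s, M s) ∈ N

/-- The structure induced on a set that is closed under the functions. -/
@[reducible]
def inducedStructure (N : Params M) (h : IsFuncClosed N) : SortedStructure L (carrier N) where
  funMap {a s} f x :=
    ⟨SortedStructure.funMap f (fun i => (x i).1), h a s f (fun i => (x i).1) fun i => (x i).2⟩
  relMap R x := SortedStructure.relMap R (fun i => (x i).1)

/-- `N` is (the universe of) an elementary substructure of `M`: it is closed under the functions,
and every formula in finitely many variables has the same truth value in `N` and in `M` at all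
tuples from `N`. -/
def IsElementary (N : Params M) : Prop :=
  ∃ h : IsFuncClosed N, ∀ (n : ℕ) (σ : Fin n → L.Sorts) (φ : Formula σ) (x : Tuple (carrier N) σ),
    @Formula.Realize L (carrier N) (inducedStructure N h) _ σ φ x ↔
      Formula.Realize (M := M) φ (fun i => (x i).1)

/-- `N` is a countable model, i.e. a countable elementary substructure of `M`. -/
def IsCountableModel (N : Params M) : Prop := N.Countable ∧ IsElementary N

end Parameters

/-! ### Equivalence relations -/

section Relations

variable {M : L.Sorts → Type u} {V : Type v} {σ : V → L.Sorts}

/-- A binary relation on a product of sorts `P`, as a subset of `P × P`, which is itself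
a product of sorts. -/
def graph (E : Tuple M σ → Tuple M σ → Prop) : Set (Tuple M (Sum.elim σ σ)) :=
  {z | ∃ x y, E x y ∧ z = join x y}

/-- `E` is an equivalence relation on the set `X` (as a set of pairs, `E` is a subset
of `X × X`). -/
structure IsEquivOn (X : Set (Tuple M σ)) (E : Tuple M σ → Tuple M σ → Prop) : Prop where
  mem : ∀ x y, E x y → x ∈ X ∧ y ∈ X
  refl : ∀ x ∈ X, E x x
  symm : ∀ x y, E x y → E y x
  trans : ∀ x y z, E x y → E y z → E x z

/-- The class of `x`. -/
def classOf (E : Tuple M σ → Tuple M σ → Prop) (x : Tuple M σ) : Set (Tuple M σ) := {y | E x y}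

/-- The restriction of a relation to a set. -/
def restrictTo (E : Tuple M σ → Tuple M σ → Prop) (Z : Set (Tuple M σ)) :
    Tuple M σ → Tuple M σ → Prop :=
  fun x y => E x y ∧ x ∈ Z ∧ y ∈ Z

/-- `Y` is `E`-saturated: it contains every `E`-class that intersects it. -/
def IsSaturatedFor (E : Tuple M σ → Tuple M σ → Prop) (Y : Set (Tuple M σ)) : Prop :=
  ∀ x y, x ∈ Y → E x y → y ∈ Y

/-- The equivalence relation `E` on `X` is bounded: it has fewer than `κ` classes. -/
def IsBounded (κ : Cardinal.{max u v}) (X : Set (Tuple M σ))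
    (E : Tuple M σ → Tuple M σ → Prop) : Prop :=
  Cardinal.mk {C : Set (Tuple M σ) // ∃ x ∈ X, C = classOf E x} < κ

variable [SortedStructure L M]

/-- The relation `E` is invariant under all automorphisms. -/
def IsInvariant (E : Tuple M σ → Tuple M σ → Prop) : Prop :=
  ∀ g ∈ Aut M, ∀ x y, E (act g x) (act g y) ↔ E x y

/-- The (invariant) relation `E` is `F_σ`: the corresponding set of types over `∅` is a countable
union of closed sets. -/
def IsFσ (E : Tuple M σ → Tuple M σ → Prop) : Prop :=
  ∃ C : ℕ → Set (TypeSpace (∅ : Params M) (Sum.elim σ σ)),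
    (∀ n, IsClosed (C n)) ∧ typesOf ∅ (graph E) = ⋃ n, C n

/-- The equivalence relation `E` on `X` is orbital: some group of automorphisms preserves every
class of `E` setwise and acts transitively on every class. -/
def IsOrbital (X : Set (Tuple M σ)) (E : Tuple M σ → Tuple M σ → Prop) : Prop :=
  ∃ Γ : Subgroup (SortPerm M), Γ ≤ Aut M ∧
    (∀ g ∈ Γ, ∀ x ∈ X, act g '' classOf E x = classOf E x) ∧
    (∀ x y, E x y → ∃ g ∈ Γ, act g x = y)

/-- The equivalence relation `E` on `X` is orbital on types: it refines the relation of having the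
same type over `∅`, and its restriction to every complete `∅`-type is orbital. -/
def IsOrbitalOnTypes (X : Set (Tuple M σ)) (E : Tuple M σ → Tuple M σ → Prop) : Prop :=
  (∀ x y, E x y → y ∈ typeClass x) ∧
    ∀ c : Tuple M σ, IsOrbital (X ∩ typeClass c) (restrictTo E (typeClass c))

/-! ### Normal forms -/

/-- `Φ n` holds of the pair `(x, y)`. -/
def HoldsAt (Φ : ℕ → Set (ParamFormula (∅ : Params M) (Sum.elim σ σ))) (n : ℕ)
    (x y : Tuple M σ) : Prop :=
  ∀ φ ∈ Φ n, Sat (join x y) φ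

/-- The distance induced by a sequence of partial types: the least `n` such that `Φ n (x, y)`
holds, and `∞` if there is none. -/
noncomputable def dist (Φ : ℕ → Set (ParamFormula (∅ : Params M) (Sum.elim σ σ)))
    (x y : Tuple M σ) : ℕ∞ :=
  ⨅ (n : ℕ) (_ : HoldsAt Φ n x y), (n : ℕ∞)

/-- The sequence `Φ` of partial types over `∅` is a normal form for the equivalence relation `E`
on `X`. -/
structure IsNormalForm (X : Set (Tuple M σ)) (E : Tuple M σ → Tuple M σ → Prop)
    (Φ : ℕ → Set (ParamFormula (∅ : Params M) (Sum.elim σ σ))) : Prop where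
  zero : ∀ x y, HoldsAt Φ 0 x y ↔ x = y ∧ x ∈ X
  mono : ∀ n x y, HoldsAt Φ n x y → HoldsAt Φ (n + 1) x y
  rel : ∀ x ∈ X, ∀ y ∈ X, (E x y ↔ ∃ n, HoldsAt Φ n x y)
  dist_eq_zero : ∀ x ∈ X, ∀ y ∈ X, (dist Φ x y = 0 ↔ x = y)
  dist_comm : ∀ x ∈ X, ∀ y ∈ X, dist Φ x y = dist Φ y x
  dist_triangle : ∀ x ∈ X, ∀ y ∈ X, ∀ z ∈ X, dist Φ x z ≤ dist Φ x y + dist Φ y z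

/-- The diameter of `C` with respect to the induced distance. -/
noncomputable def diam (Φ : ℕ → Set (ParamFormula (∅ : Params M) (Sum.elim σ σ)))
    (C : Set (Tuple M σ)) : ℕ∞ :=
  ⨆ (x ∈ C) (y ∈ C), dist Φ x y

/-! ### Smoothness -/

/-- The relation `E^N` induced by `E` on the space of types over `N`. -/
def inducedRel (E : Tuple M σ → Tuple M σ → Prop) (N : Params M) (p q : TypeSpace N σ) : Prop :=
  ∃ x y, tp N x = p.1 ∧ tp N y = q.1 ∧ E x y

/-- The restriction of `E^N` to `Y_N = {tp(y/N) | y ∈ Y}` is smooth: it is Borel reducible to the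
equality on a Polish space. (Polish spaces have at most continuum many points, so nothing is lost
by taking the Polish space in the lowest universe.) -/
def IsSmoothOver (N : Params M) (E : Tuple M σ → Tuple M σ → Prop) (Y : Set (Tuple M σ)) : Prop :=
  ∃ (Z : Type) (_ : TopologicalSpace Z) (_ : PolishSpace Z) (f : typesOf N Y → Z),
    @Measurable _ _ (borel (typesOf N Y)) (borel Z) f ∧
      ∀ p q : typesOf N Y, inducedRel E N p.1 q.1 ↔ f p = f q

/-- `E` restricted to `Y` is smooth: `E^N` restricted to `Y_N` is smooth for a countable
model `N`. -/
def IsSmoothOn (E : Tuple M σ → Tuple M σ → Prop) (Y : Set (Tuple M σ)) : Prop :=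
  ∃ N : Params M, IsCountableModel N ∧ IsSmoothOver N E Y

end Relations

end ManySorted

/-! The main implication is that smoothness on a pseudo-closed saturated set of elements of one type
forces finite diameter (`IsSmoothOver.diam_lt_top`). The group `Γ` witnessing orbitality acts on the
compact space of ultrafilters on tuples. Those containing `Y` form a closed invariant set, so there
is a minimal subsystem among them. Sending an ultrafilter to its type over the countable model and
applying the Borel reduction gives a Borel map, invariant because `Γ` moves points inside their
`E`-classes. Invariant Borel sets in a minimal compact system are meagre or comeagre
(`mem_residual_or_compl_mem_residual`), so this map is constant on a comeagre set. Bounded invariant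
relations are coarser than equality of types over a model (`IsBounded.rel_of_tp_eq`), so
realisations of generic ultrafilters all lie in one class, that of some `c`.

This class is a countable union of balls about `c`. Their traces on the system are closed, so by
Baire category one has interior, and finitely many translates of it cover the system. The centres
are `Γ`-translates of `c`, hence at bounded mutual distance. Comparing one ultrafilter with its
images under `Γ` then bounds a whole `Γ`-orbit of elements, and by transitivity this orbit is an
`E`-class.

The other implications are softer. Automorphisms carry a diameter bound to every class in the type
of `a`, and a uniform bound `n` identifies `E` there with `Φ n`, which is type-definable.
Type-definability makes each class pseudo-closed, and makes saturations of basic clopen sets closed,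
so that membership in them is a reduction to Cantor space (`isSmoothOver_of_isTypeDefinable`).
Finally, `E` is trivially smooth on a single class, so a pseudo-closed class can itself play the
role of `Y` in the main implication. -/

section GenericErgodicity

/-! ### Minimal systems and generic ergodicity. -/

open Topology Filter
open scoped Pointwise

/-- A nonempty closed invariant set of a compact space contains a minimal subsystem. -/
theorem exists_subMulAction_isMinimal {G X : Type*} [Group G] [TopologicalSpace X]
    [CompactSpace X] [MulAction G X] [ContinuousConstSMul G X] (C : Set X) (hC : IsClosed C)
    (hne : C.Nonempty) (hinv : ∀ (g : G), ∀ x ∈ C, g • x ∈ C) :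
    ∃ p : SubMulAction G X, (p : Set X) ⊆ C ∧ IsClosed (p : Set X) ∧ Nonempty p ∧
      MulAction.IsMinimal G p := by
  let S : Set (Set X) := {K | IsClosed K ∧ K.Nonempty ∧ ∀ (g : G), ∀ x ∈ K, g • x ∈ K}
  obtain ⟨K, hKC, hK⟩ := zorn_superset_nonempty S (by
    intro c hcS hc hcne
    refine ⟨⋂₀ c, ⟨isClosed_sInter fun s hs => (hcS hs).1, ?_, ?_⟩, fun s hs =>
      Set.sInter_subset_of_mem hs⟩
    · have : Nonempty c := hcne.to_subtype
      rw [Set.sInter_eq_iInter]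
      refine IsCompact.nonempty_iInter_of_directed_nonempty_isCompact_isClosed _ ?_
        (fun i => (hcS i.2).2.1) (fun i => (hcS i.2).1.isCompact) (fun i => (hcS i.2).1)
      have hd : DirectedOn (fun s t : Set X => s ⊇ t) c := by
        intro s hs t ht
        rcases hc.total hs ht with h | h
        · exact ⟨s, hs, subset_rfl, h⟩
        · exact ⟨t, ht, h, subset_rfl⟩
      exact hd.directed_val
    · intro g x hx s hs
      exact (hcS hs).2.2 g x (hx s hs)) C ⟨hC, hne, hinv⟩
  obtain ⟨hKcl, hKne, hKinv⟩ := hK.prop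
  let p : SubMulAction G X := ⟨K, fun g {x} hx => hKinv g x hx⟩
  refine ⟨p, hKC, hKcl, hKne.to_subtype, ⟨fun x => ?_⟩⟩
  -- The closure of an orbit in `K` is again a member of `S`, so it equals `K` by minimality, and
  -- every orbit is dense.
  have hsub : closure (MulAction.orbit G x.1) ⊆ K :=
    closure_minimal (by rintro _ ⟨g, rfl⟩; exact hKinv g _ x.2) hKcl
  have hmem : closure (MulAction.orbit G x.1) ∈ S := by
    refine ⟨isClosed_closure, (MulAction.nonempty_orbit _).closure, fun g y hy => ?_⟩
    exact smul_closure_orbit_subset g x.1 ⟨y, hy, rfl⟩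
  have heq : K ⊆ closure (MulAction.orbit G x.1) := hK.le_of_le hmem hsub
  intro y
  rw [closure_subtype]
  have hy : (y : X) ∈ closure (MulAction.orbit G x.1) := heq y.2
  convert hy using 2
  ext z
  constructor
  · rintro ⟨_, ⟨g, rfl⟩, rfl⟩
    exact ⟨g, rfl⟩
  · rintro ⟨g, rfl⟩
    exact ⟨g • x, ⟨g, rfl⟩, rfl⟩

variable {G X : Type*} [Group G] [TopologicalSpace X] [MulAction G X]
  [ContinuousConstSMul G X]

theorem eventually_residual_smul (g : G) {P : X → Prop} (h : ∀ᶠ x in residual X, P x) :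
    ∀ᶠ x in residual X, P (g • x) :=
  (tendsto_residual_of_isOpenMap (continuous_const_smul g) (isOpenMap_smul g)).eventually h

/-- Invariant Borel sets of a minimal compact system are meagre or comeagre. -/
theorem mem_residual_or_compl_mem_residual [CompactSpace X] [MulAction.IsMinimal G X] {S : Set X}
    (hS : @MeasurableSet X (borel X) S) (hinv : ∀ (g : G) (x : X), g • x ∈ S ↔ x ∈ S) :
    S ∈ residual X ∨ Sᶜ ∈ residual X := by
  let : MeasurableSpace X := borel X
  have : BorelSpace X := ⟨rfl⟩
  -- Baire property: `S` agrees with an open set `V` up to a meagre set.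
  obtain ⟨V, hV, hSV⟩ := hS.residualEq_isOpen
  rcases V.eq_empty_or_nonempty with rfl | hne
  · right
    filter_upwards [hSV] with x hx hxS
    exact (hx.mp hxS : x ∈ (∅ : Set X))
  · left
    -- Finitely many translates of `V` cover the space, and by invariance `S` contains each of them
    -- up to a meagre set.
    obtain ⟨I, hI⟩ := isCompact_univ.exists_finite_cover_smul (G := G) hV hne
    have key : ∀ᶠ x in residual X, ∀ g ∈ I, g⁻¹ • x ∈ V → g⁻¹ • x ∈ S := by
      rw [Filter.eventually_all_finset]
      intro g _
      exact eventually_residual_smul (P := fun x => x ∈ V → x ∈ S) g⁻¹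
        (by filter_upwards [hSV] with x hx hxV using hx.mpr hxV)
    filter_upwards [key] with x hx
    obtain ⟨g, hg, hxg⟩ : ∃ g ∈ I, x ∈ g • V := by simpa using hI (Set.mem_univ x)
    exact (hinv g⁻¹ x).mp (hx g hg (Set.mem_smul_set_iff_inv_smul_mem.mp hxg))

/-- Invariant Borel maps on a minimal compact system are constant on a comeagre set. -/
theorem exists_eventually_residual_eq [CompactSpace X] [T2Space X] [Nonempty X]
    [MulAction.IsMinimal G X] {Z : Type*} [TopologicalSpace Z] [SecondCountableTopology Z]
    [T0Space Z] {F : X → Z} (hF : @Measurable _ _ (borel X) (borel Z) F)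
    (hinv : ∀ (g : G) (x : X), F (g • x) = F x) :
    ∃ x₀, ∀ᶠ x in residual X, F x = F x₀ := by
  let B := TopologicalSpace.countableBasis Z
  have hB := TopologicalSpace.isBasis_countableBasis Z
  -- The points of `T` have images in exactly the same basic open sets, so `F` is constant on `T` by
  -- the T₀ property.
  let T : Set X := {x | ∀ u ∈ B, F x ∈ u ↔ F ⁻¹' u ∈ residual X}
  have hT : T ∈ residual X := by
    refine (eventually_countable_ball (TopologicalSpace.countable_countableBasis Z)).mpr ?_
    intro u hu
    rcases mem_residual_or_compl_mem_residual (G := G) (S := F ⁻¹' u)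
      (hF (MeasurableSpace.measurableSet_generateFrom (hB.isOpen hu)))
      (fun g x => by simp only [Set.mem_preimage, hinv]) with h | h
    · filter_upwards [h] with x hx using iff_of_true hx h
    · filter_upwards [h] with x hx
      refine iff_of_false hx fun h' => ?_
      obtain ⟨y, hy, hy'⟩ := (dense_of_mem_residual (Filter.inter_mem h h')).nonempty
      exact hy hy'
  obtain ⟨x₀, hx₀⟩ := (dense_of_mem_residual hT).nonempty
  refine ⟨x₀, ?_⟩
  filter_upwards [hT] with x hx
  exact hB.eq_iff.mpr fun u hu => (hx u hu).trans (hx₀ u hu).symm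

/-- Baire category relative to a dense Gδ set: when countably many closed sets cover it, the union
of their interiors is dense. -/
theorem exists_interior_nonempty_of_eventually_residual {X : Type*} [TopologicalSpace X]
    [BaireSpace X] [Nonempty X] {B : ℕ → Set X} (hB : ∀ n, IsClosed (B n))
    (h : ∀ᶠ x in residual X, ∃ n, x ∈ B n) : ∃ n, (interior (B n)).Nonempty := by
  obtain ⟨t, hts, htG, htd⟩ := mem_residual.mp h
  obtain ⟨x, hx⟩ := (htG.dense_iUnion_interior_of_closed htd hB
    (fun x hx => Set.mem_iUnion.mpr (hts hx))).nonempty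
  obtain ⟨n, hn⟩ := Set.mem_iUnion.mp hx
  exact ⟨n, x, hn⟩

end GenericErgodicity

namespace ManySorted

/-! ### Substitution of terms into formulas. -/

section Substitution

variable {L : SortedLanguage.{u}}

/-- Simultaneous substitution of terms for the variables of a term. -/
def Term.subst {V : Type v} {W : Type w} {σ : V → L.Sorts} {τ : W → L.Sorts}
    (ρ : ∀ i, Term τ (σ i)) : ∀ {s : L.Sorts}, Term σ s → Term τ s
  | _, .var i => ρ i
  | _, .func f ts => .func f fun i => (ts i).subst ρ

/-- The extension of a substitution to one more bound variable. -/
def liftSubst {V : Type v} {W : Type w} {σ : V → L.Sorts} {τ : W → L.Sorts} {l l' : List L.Sorts}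
    (s : L.Sorts) (ρ : ∀ i, Term (Sum.elim τ l'.get) (Sum.elim σ l.get i)) :
    ∀ i, Term (Sum.elim τ (s :: l').get) (Sum.elim σ (s :: l).get i) :=
  let up : ∀ j, Term (Sum.elim τ (s :: l').get) (Sum.elim τ l'.get j) := fun j =>
    match j with
    | .inl w => .var (σ := Sum.elim τ (s :: l').get) (.inl w)
    | .inr k => .var (σ := Sum.elim τ (s :: l').get) (.inr k.succ)
  fun i => match i with
    | .inl v => (ρ (.inl v)).subst up
    | .inr k => Fin.cases
        (motive := fun k => Term (Sum.elim τ (s :: l').get) (Sum.elim σ (s :: l).get (.inr k)))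
        (.var (σ := Sum.elim τ (s :: l').get) (.inr 0)) (fun k => (ρ (.inr k)).subst up) k

/-- Simultaneous substitution of terms for all the variables of a formula that are not bound. -/
def BFormula.subst {V : Type v} {W : Type w} {σ : V → L.Sorts} {τ : W → L.Sorts} :
    ∀ {l : List L.Sorts}, BFormula σ l → ∀ {l' : List L.Sorts},
      (∀ i, Term (Sum.elim τ l'.get) (Sum.elim σ l.get i)) → BFormula τ l'
  | _, .falsum, _, _ => .falsum
  | _, .equal t₁ t₂, _, ρ => .equal (t₁.subst ρ) (t₂.subst ρ)
  | _, .rel R ts, _, ρ => .rel R fun i => (ts i).subst ρ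
  | _, .imp φ ψ, _, ρ => .imp (φ.subst ρ) (ψ.subst ρ)
  | _, .all (s := s) φ, _, ρ => .all (φ.subst (liftSubst s ρ))

variable {M : L.Sorts → Type u} [SortedStructure L M]

theorem Term.eval_subst {V : Type v} {W : Type w} {σ : V → L.Sorts} {τ : W → L.Sorts}
    (ρ : ∀ i, Term τ (σ i)) (x : Tuple M τ) :
    ∀ {s : L.Sorts} (t : Term σ s), (t.subst ρ).eval x = t.eval fun i => (ρ i).eval x
  | _, .var i => rfl
  | _, .func f ts => by
    simp only [Term.subst, Term.eval]
    congr 1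
    funext i
    exact Term.eval_subst ρ x (ts i)

theorem eval_liftSubst {V : Type v} {W : Type w} {σ : V → L.Sorts} {τ : W → L.Sorts}
    {l l' : List L.Sorts} (s : L.Sorts)
    (ρ : ∀ i, Term (Sum.elim τ l'.get) (Sum.elim σ l.get i)) (x : Tuple M τ) (y : Tuple M l'.get)
    (m : M s) :
    (fun i => (liftSubst s ρ i).eval (join x (consTuple m y))) =
      join (fun v => (ρ (.inl v)).eval (join x y))
        (consTuple m fun k => (ρ (.inr k)).eval (join x y)) := by
  have hup : ∀ j, (match j with
      | .inl w => Term.var (σ := Sum.elim τ (s :: l').get) (.inl w)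
      | .inr k => Term.var (σ := Sum.elim τ (s :: l').get) (.inr k.succ) :
        Term (Sum.elim τ (s :: l').get) (Sum.elim τ l'.get j)).eval
        (join x (consTuple m y)) = join x y j := by
    rintro (w | k) <;> rfl
  funext i
  rcases i with v | k
  · exact (Term.eval_subst _ _ _).trans
      (congrArg (fun z => Term.eval z (ρ (.inl v))) (funext hup))
  · refine Fin.cases ?_ (fun k => ?_) k
    · rfl
    · exact (Term.eval_subst _ _ _).trans
        (congrArg (fun z => Term.eval z (ρ (.inr k))) (funext hup))

theorem BFormula.holds_subst {V : Type v} {W : Type w} {σ : V → L.Sorts} {τ : W → L.Sorts} :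
    ∀ {l : List L.Sorts} (φ : BFormula σ l) {l' : List L.Sorts}
      (ρ : ∀ i, Term (Sum.elim τ l'.get) (Sum.elim σ l.get i)) (x : Tuple M τ)
      (y : Tuple M l'.get),
      (φ.subst ρ).Holds x y ↔ φ.Holds (fun v => (ρ (.inl v)).eval (join x y))
        (fun k => (ρ (.inr k)).eval (join x y)) := by
  have hj : ∀ {l l' : List L.Sorts} (ρ : ∀ i, Term (Sum.elim τ l'.get) (Sum.elim σ l.get i))
      (x : Tuple M τ) (y : Tuple M l'.get), (fun i => (ρ i).eval (join x y)) =
      join (fun v => (ρ (.inl v)).eval (join x y)) (fun k => (ρ (.inr k)).eval (join x y)) := by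
    intro l l' ρ x y
    funext i
    rcases i with v | k <;> rfl
  intro l φ
  induction φ with
  | falsum => intros; exact Iff.rfl
  | equal t₁ t₂ =>
    intro l' ρ x y
    simp only [BFormula.subst, BFormula.Holds, Term.eval_subst, hj]
    exact Iff.rfl
  | rel R ts =>
    intro l' ρ x y
    simp only [BFormula.subst, BFormula.Holds, Term.eval_subst, hj]
    exact Iff.rfl
  | imp φ ψ ih₁ ih₂ =>
    intro l' ρ x y
    simp only [BFormula.subst, BFormula.Holds, ih₁, ih₂]
  | @all l s φ ih =>
    intro l' ρ x y
    simp only [BFormula.subst, BFormula.Holds]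
    refine forall_congr' fun m => ?_
    rw [ih]
    have h := eval_liftSubst s ρ x y m
    have h₁ : (fun v => (liftSubst s ρ (.inl v)).eval (join x (consTuple m y))) =
        fun v => (ρ (.inl v)).eval (join x y) := by
      funext v; exact congrFun h (.inl v)
    have h₂ : (fun k => (liftSubst s ρ (.inr k)).eval (join x (consTuple m y))) =
        consTuple m fun k => (ρ (.inr k)).eval (join x y) := by
      funext k; exact congrFun h (.inr k)
    rw [h₁, h₂]
    exact Iff.rfl

/-- Substitution of terms for the free variables of a formula. -/
def Formula.subst {V : Type v} {W : Type w} {σ : V → L.Sorts} {τ : W → L.Sorts}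
    (φ : Formula σ) (ρ : ∀ i, Term τ (σ i)) : Formula τ :=
  BFormula.subst φ fun i => match i with
    | .inl v => (ρ v).subst fun w => .var (σ := Sum.elim τ ([] : List L.Sorts).get) (.inl w)
    | .inr k => k.elim0

theorem Formula.realize_subst {V : Type v} {W : Type w} {σ : V → L.Sorts} {τ : W → L.Sorts}
    (φ : Formula σ) (ρ : ∀ i, Term τ (σ i)) (x : Tuple M τ) :
    (φ.subst ρ).Realize x ↔ φ.Realize fun i => (ρ i).eval x := by
  unfold Formula.Realize Formula.subst
  rw [BFormula.holds_subst]
  refine iff_of_eq ?_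
  congr 1
  · exact funext fun v => Term.eval_subst _ _ _
  · exact funext fun k => k.elim0

end Substitution

/-! ### Derived connectives and quantification over free variables. -/

section Connectives

variable {L : SortedLanguage.{u}} {V : Type v} {σ : V → L.Sorts}

/-- Negation. -/
def Formula.neg (φ : Formula σ) : Formula σ := BFormula.imp φ BFormula.falsum

/-- Conjunction. -/
def Formula.and (φ ψ : Formula σ) : Formula σ := Formula.neg (BFormula.imp φ (Formula.neg ψ))

/-- The true formula. -/
def Formula.verum : Formula σ := Formula.neg BFormula.falsum

/-- Existential quantification over a free variable, which remains as a dummy variable. -/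
noncomputable def Formula.exVar (v : V) (φ : Formula σ) : Formula σ :=
  Formula.neg (BFormula.all (s := σ v) (BFormula.subst (Formula.neg φ)
    (fun i => match i with
    | .inl w => open Classical in
      if h : w = v then
        h ▸ (Term.var (σ := Sum.elim σ [σ v].get) (.inr 0) : Term (Sum.elim σ [σ v].get) (σ v))
      else .var (σ := Sum.elim σ [σ v].get) (.inl w)
    | .inr k => k.elim0)))

/-- Existential quantification over finitely many free variables. -/
noncomputable def Formula.exList : List V → Formula σ → Formula σ
  | [], φ => φ
  | v :: l, φ => Formula.exVar v (Formula.exList l φ)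

variable {M : L.Sorts → Type u} [SortedStructure L M]

@[simp] theorem Formula.realize_neg (φ : Formula σ) (x : Tuple M σ) :
    φ.neg.Realize x ↔ ¬ φ.Realize x := Iff.rfl

@[simp] theorem Formula.realize_and (φ ψ : Formula σ) (x : Tuple M σ) :
    (φ.and ψ).Realize x ↔ φ.Realize x ∧ ψ.Realize x := by
  have : (φ.and ψ).Realize x ↔ ¬ (φ.Realize x → ¬ ψ.Realize x) := Iff.rfl
  rw [this]
  tauto

@[simp] theorem Formula.realize_verum (x : Tuple M σ) :
    (Formula.verum : Formula σ).Realize x := fun h => h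

open Classical in
theorem Formula.realize_exVar (v : V) (φ : Formula σ) (x : Tuple M σ) :
    (φ.exVar v).Realize x ↔ ∃ m, φ.Realize (Function.update x v m) := by
  unfold Formula.exVar
  rw [Formula.realize_neg]
  unfold Formula.Realize
  simp only [BFormula.Holds, BFormula.holds_subst]
  rw [not_forall]
  refine exists_congr fun m => ?_
  have : ∀ z, BFormula.Holds (M := M) z (Formula.neg φ) (fun i => i.elim0) ↔
    ¬ BFormula.Holds z φ (fun i => i.elim0) := fun z => Iff.rfl
  rw [← not_iff_not, not_not, ← this]
  refine iff_of_eq ?_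
  congr 1
  · funext w
    by_cases h : w = v
    · subst h
      simp [Term.eval, join, consTuple]
    · simp [h, Term.eval, join]
  · funext k
    exact k.elim0

theorem Formula.realize_exList (l : List V) (φ : Formula σ) (x : Tuple M σ) :
    (φ.exList l).Realize x ↔ ∃ x' : Tuple M σ, (∀ v, v ∉ l → x' v = x v) ∧ φ.Realize x' := by
  classical
  induction l generalizing x with
  | nil =>
    constructor
    · exact fun h => ⟨x, fun _ _ => rfl, h⟩
    · rintro ⟨x', h, hx'⟩
      rwa [show x' = x from funext fun v => h v (by simp)] at hx'
  | cons v l ih =>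
    rw [Formula.exList, Formula.realize_exVar]
    constructor
    · rintro ⟨m, hm⟩
      obtain ⟨x', h, hx'⟩ := (ih _).mp hm
      refine ⟨x', fun w hw => ?_, hx'⟩
      rw [List.mem_cons, not_or] at hw
      rw [h w hw.2, Function.update_of_ne hw.1]
    · rintro ⟨x', h, hx'⟩
      refine ⟨x' v, (ih _).mpr ⟨x', fun w hw => ?_, hx'⟩⟩
      by_cases hwv : w = v
      · subst hwv; simp
      · rw [Function.update_of_ne hwv]
        exact h w (by simp [hwv, hw])

end Connectives

/-! ### Finite supports of formulas. -/

section Support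

variable {L : SortedLanguage.{u}} {V : Type v} {σ : V → L.Sorts}

/-- Allowing every `F ⊇ F₀` lets the supports of subterms be merged. The restricted term is chosen
before the structure, so that it serves a model and the ambient structure at once. -/
theorem Term.exists_support {l : List L.Sorts} {s : L.Sorts} (t : Term (Sum.elim σ l.get) s) :
    ∃ F₀ : Finset V, ∀ F : Finset V, F₀ ⊆ F →
      ∃ t' : Term (Sum.elim (fun v : F => σ v) l.get) s,
        ∀ (M : L.Sorts → Type u) [SortedStructure L M] (x : Tuple M σ) (y : Tuple M l.get),
          t'.eval (join (fun v : F => x v) y) = t.eval (join x y) := by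
  classical
  induction t with
  | var i =>
    rcases i with v | k
    · exact ⟨{v}, fun F hF => ⟨.var (σ := Sum.elim (fun v : F => σ v) l.get)
        (.inl ⟨v, hF (by simp)⟩), fun M _ x y => rfl⟩⟩
    · exact ⟨∅, fun F hF => ⟨.var (σ := Sum.elim (fun v : F => σ v) l.get) (.inr k),
        fun M _ x y => rfl⟩⟩
  | func f ts ih =>
    choose F₀ h using ih
    refine ⟨Finset.univ.biUnion F₀, fun F hF => ?_⟩
    choose ts' h' using fun i =>
      h i F ((Finset.subset_biUnion_of_mem F₀ (Finset.mem_univ i)).trans hF)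
    refine ⟨.func f ts', fun M _ x y => ?_⟩
    simp only [Term.eval, h']

/-- Every formula involves only finitely many free variables. -/
theorem BFormula.exists_support {l : List L.Sorts} (φ : BFormula σ l) :
    ∃ F₀ : Finset V, ∀ F : Finset V, F₀ ⊆ F →
      ∃ φ' : BFormula (fun v : F => σ v) l,
        ∀ (M : L.Sorts → Type u) [SortedStructure L M] (x : Tuple M σ) (y : Tuple M l.get),
          φ'.Holds (fun v : F => x v) y ↔ φ.Holds x y := by
  classical
  induction φ with
  | falsum => exact ⟨∅, fun F _ => ⟨.falsum, fun M _ x y => Iff.rfl⟩⟩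
  | equal t₁ t₂ =>
    obtain ⟨F₁, h₁⟩ := t₁.exists_support
    obtain ⟨F₂, h₂⟩ := t₂.exists_support
    refine ⟨F₁ ∪ F₂, fun F hF => ?_⟩
    obtain ⟨t₁', h₁'⟩ := h₁ F (Finset.union_subset_left hF)
    obtain ⟨t₂', h₂'⟩ := h₂ F (Finset.union_subset_right hF)
    refine ⟨.equal t₁' t₂', fun M _ x y => ?_⟩
    simp only [BFormula.Holds, h₁', h₂']
  | rel R ts =>
    choose F₀ h using fun i => (ts i).exists_support
    refine ⟨Finset.univ.biUnion F₀, fun F hF => ?_⟩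
    choose ts' h' using fun i =>
      h i F ((Finset.subset_biUnion_of_mem F₀ (Finset.mem_univ i)).trans hF)
    refine ⟨.rel R ts', fun M _ x y => ?_⟩
    simp only [BFormula.Holds, h']
  | imp φ ψ ih₁ ih₂ =>
    obtain ⟨F₁, h₁⟩ := ih₁
    obtain ⟨F₂, h₂⟩ := ih₂
    refine ⟨F₁ ∪ F₂, fun F hF => ?_⟩
    obtain ⟨t₁', h₁'⟩ := h₁ F (Finset.union_subset_left hF)
    obtain ⟨t₂', h₂'⟩ := h₂ F (Finset.union_subset_right hF)
    refine ⟨.imp t₁' t₂', fun M _ x y => ?_⟩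
    simp only [BFormula.Holds, h₁', h₂']
  | all φ ih =>
    obtain ⟨F₀, h⟩ := ih
    refine ⟨F₀, fun F hF => ?_⟩
    obtain ⟨φ', h'⟩ := h F hF
    exact ⟨.all φ', fun M _ x y => forall_congr' fun m => h' M x _⟩

theorem Formula.exists_finset_congr (φ : Formula σ) :
    ∃ F : Finset V, ∀ (M : L.Sorts → Type u) [SortedStructure L M] (x x' : Tuple M σ),
      (∀ v ∈ F, x v = x' v) → (φ.Realize x ↔ φ.Realize x') := by
  obtain ⟨F, h⟩ := BFormula.exists_support φ
  obtain ⟨φ', h'⟩ := h F subset_rfl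
  refine ⟨F, fun M _ x x' hx => ?_⟩
  unfold Formula.Realize
  rw [← h', ← h', show (fun v : F => x v) = fun v : F => x' v from funext fun v => hx v v.2]

end Support

/-! ### Countability of the sets of terms and formulas. -/

section Countability

variable {L : SortedLanguage.{u}} {V : Type v}

theorem Term.countable [hL : L.IsCountable] [Countable V] (σ : V → L.Sorts) (s : L.Sorts) :
    Countable (Term σ s) := by
  have := hL.sorts
  have := hL.func
  -- The terms of height less than `n`; variables and constants have height zero.
  let T : ℕ → ∀ s, Set (Term σ s) := fun n => Nat.rec (fun _ => ∅) (fun _ T s =>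
    {t | ∃ v : V, ∃ h : σ v = s, t = h ▸ .var v} ∪
      ⋃ (a : List L.Sorts) (f : L.Func a s), (fun ts => Term.func f ts) '' {ts | ∀ i, ts i ∈ T _}) n
  have hT : ∀ n s, T (n + 1) s = {t | ∃ v : V, ∃ h : σ v = s, t = h ▸ .var v} ∪
      ⋃ (a : List L.Sorts) (f : L.Func a s),
        (fun ts => Term.func f ts) '' {ts | ∀ i, ts i ∈ T n _} := fun n s => rfl
  have hc : ∀ n s, (T n s).Countable := by
    intro n
    induction n with
    | zero => exact fun s => Set.countable_empty
    | succ n ih =>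
      intro s
      rw [hT]
      refine Set.Countable.union ?_ (Set.countable_iUnion fun a => Set.countable_iUnion fun f =>
        Set.Countable.image (Set.countable_pi fun i => ih _) _)
      have : {t : Term σ s | ∃ v : V, ∃ h : σ v = s, t = h ▸ .var v} =
          ⋃ v : V, {t : Term σ s | ∃ h : σ v = s, t = h ▸ .var v} := by ext; simp
      rw [this]
      refine Set.countable_iUnion fun v => Set.Subsingleton.countable ?_
      rintro _ ⟨_, rfl⟩ _ ⟨_, rfl⟩
      rfl
  have hmono : ∀ n s, T n s ⊆ T (n + 1) s := by
    intro n
    induction n with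
    | zero => exact fun s => Set.empty_subset _
    | succ n ih =>
      intro s
      rw [hT (n + 1), hT n]
      refine Set.union_subset_union_right _ (Set.iUnion_mono fun a => Set.iUnion_mono fun f =>
        Set.image_mono fun ts h i => ih _ (h i))
  have hmono' : ∀ s, Monotone fun n => T n s := fun s => monotone_nat_of_le_succ fun n => hmono n s
  have hall : ∀ s (t : Term σ s), ∃ n, t ∈ T n s := by
    intro s t
    induction t with
    | var v => exact ⟨1, Or.inl ⟨v, rfl, rfl⟩⟩
    | @func a s f ts ih =>
      choose n hn using ih
      refine ⟨Finset.univ.sup n + 1, Or.inr ?_⟩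
      simp only [Set.mem_iUnion]
      exact ⟨a, f, ts, fun i => hmono' _ (Finset.le_sup (Finset.mem_univ i)) (hn i), rfl⟩
  rw [← Set.countable_univ_iff]
  exact (Set.countable_iUnion fun n => hc n s).mono fun t _ => Set.mem_iUnion.mpr (hall s t)

theorem BFormula.countable [hL : L.IsCountable] [Countable V] (σ : V → L.Sorts)
    (l : List L.Sorts) : Countable (BFormula σ l) := by
  have := hL.sorts
  have := hL.rel
  have := fun (l : List L.Sorts) s => Term.countable (Sum.elim σ l.get) s
  let T : ℕ → ∀ l, Set (BFormula σ l) := fun n => Nat.rec (fun _ => ∅) (fun _ T l =>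
    {.falsum} ∪ (⋃ s : L.Sorts, Set.range fun t : Term _ s × Term _ s => .equal t.1 t.2) ∪
      (⋃ (a : List L.Sorts) (R : L.Rel a), Set.range fun ts => .rel R ts) ∪
      (Set.image2 .imp (T l) (T l)) ∪ ⋃ s : L.Sorts, BFormula.all '' T (s :: l)) n
  have hc : ∀ n l, (T n l).Countable := by
    intro n
    induction n with
    | zero => exact fun s => Set.countable_empty
    | succ n ih =>
      intro l
      exact ((((Set.countable_singleton _).union (Set.countable_iUnion fun s =>
        Set.countable_range _)).union (Set.countable_iUnion fun a => Set.countable_iUnion fun R =>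
        Set.countable_range _)).union ((ih l).image2 (ih l) _)).union
        (Set.countable_iUnion fun s => (ih _).image _)
  have hmono : ∀ n l, T n l ⊆ T (n + 1) l := by
    intro n
    induction n with
    | zero => exact fun s => Set.empty_subset _
    | succ n ih =>
      intro l
      exact Set.union_subset_union (Set.union_subset_union subset_rfl
        (Set.image2_subset (ih l) (ih l)))
        (Set.iUnion_mono fun s => Set.image_mono (ih _))
  have hmono' : ∀ l, Monotone fun n => T n l := fun l => monotone_nat_of_le_succ fun n => hmono n l
  have hall : ∀ l (φ : BFormula σ l), ∃ n, φ ∈ T n l := by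
    intro l φ
    induction φ with
    | falsum => exact ⟨1, .inl (.inl (.inl (.inl rfl)))⟩
    | equal t₁ t₂ =>
      exact ⟨1, .inl (.inl (.inl (.inr (Set.mem_iUnion.mpr ⟨_, ⟨t₁, t₂⟩, rfl⟩))))⟩
    | rel R ts =>
      exact ⟨1, .inl (.inl (.inr (Set.mem_iUnion.mpr ⟨_, Set.mem_iUnion.mpr ⟨R, ts, rfl⟩⟩)))⟩
    | @imp l φ ψ ih₁ ih₂ =>
      obtain ⟨n₁, h₁⟩ := ih₁
      obtain ⟨n₂, h₂⟩ := ih₂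
      exact ⟨max n₁ n₂ + 1, .inl (.inr ⟨φ, hmono' l (le_max_left _ _) h₁, ψ,
        hmono' l (le_max_right _ _) h₂, rfl⟩)⟩
    | all φ ih =>
      obtain ⟨n, h⟩ := ih
      exact ⟨n + 1, .inr (Set.mem_iUnion.mpr ⟨_, φ, h, rfl⟩)⟩
  rw [← Set.countable_univ_iff]
  exact (Set.countable_iUnion fun n => hc n l).mono fun t _ => Set.mem_iUnion.mpr (hall l t)

end Countability

/-! ### Automorphisms preserve satisfaction. -/

section Automorphisms

variable {L : SortedLanguage.{u}} {V : Type v} {M : L.Sorts → Type u}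

theorem act_join {W : Type w} {σ : V → L.Sorts} {τ : W → L.Sorts} (g : SortPerm M)
    (x : Tuple M σ) (y : Tuple M τ) : act g (join x y) = join (act g x) (act g y) := by
  funext i
  rcases i with i | i <;> rfl

theorem act_consTuple {s : L.Sorts} {l : List L.Sorts} (g : SortPerm M) (m : M s)
    (y : Tuple M l.get) : act g (consTuple m y) = consTuple (g s m) (act g y) := by
  funext k
  refine Fin.cases ?_ (fun k => ?_) k <;> rfl

variable [SortedStructure L M]

theorem Term.eval_act {σ : V → L.Sorts} {g : SortPerm M} (hg : g ∈ Aut M) (x : Tuple M σ)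
    {s : L.Sorts} (t : Term σ s) : t.eval (act g x) = g s (t.eval x) := by
  induction t with
  | var v => rfl
  | func f ts ih =>
    simp only [Term.eval, ih]
    exact (hg.1 _ _ f _).symm

theorem BFormula.holds_act {σ : V → L.Sorts} {g : SortPerm M} (hg : g ∈ Aut M) (x : Tuple M σ)
    {l : List L.Sorts} (φ : BFormula σ l) (y : Tuple M l.get) :
    φ.Holds (act g x) (act g y) ↔ φ.Holds x y := by
  induction φ with
  | falsum => exact Iff.rfl
  | equal t₁ t₂ =>
    simp only [BFormula.Holds, ← act_join, Term.eval_act hg, EmbeddingLike.apply_eq_iff_eq]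
  | rel R ts =>
    simp only [BFormula.Holds, ← act_join, Term.eval_act hg]
    exact hg.2 _ R _
  | imp φ ψ ih₁ ih₂ => simp only [BFormula.Holds, ih₁, ih₂]
  | @all l s φ ih =>
    simp only [BFormula.Holds]
    constructor
    · intro h m
      have := h (g s m)
      rw [← act_consTuple] at this
      exact (ih _).mp this
    · intro h m
      have := (ih (consTuple ((g s).symm m) y)).mpr (h _)
      rw [act_consTuple] at this
      simpa using this

theorem Formula.realize_act {σ : V → L.Sorts} {g : SortPerm M} (hg : g ∈ Aut M) (x : Tuple M σ)
    (φ : Formula σ) : φ.Realize (act g x) ↔ φ.Realize x := by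
  unfold Formula.Realize
  rw [← BFormula.holds_act hg x φ]
  refine iff_of_eq ?_
  congr 1
  exact funext fun k => k.elim0

end Automorphisms

/-! ### Coordinates of tuples and pairs. -/

section Tuples

variable {L : SortedLanguage.{u}} {M : L.Sorts → Type u}
  {V : Type v} {W : Type w} {σ : V → L.Sorts} {τ : W → L.Sorts} {A : Params M}

/-- The set of the coordinates of a tuple. -/
def coords (c : Tuple M σ) : Params M := Set.range fun i => ⟨σ i, c i⟩

theorem mem_coords (c : Tuple M σ) (i : V) : (⟨σ i, c i⟩ : Σ s, M s) ∈ coords c := ⟨i, rfl⟩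

theorem countable_coords [Countable V] (c : Tuple M σ) : (coords c).Countable :=
  Set.countable_range _

/-- The first component of a concatenation of two tuples. -/
def fstTuple (z : Tuple M (Sum.elim σ τ)) : Tuple M σ := fun i => z (.inl i)

/-- The second component of a concatenation of two tuples. -/
def sndTuple (z : Tuple M (Sum.elim σ τ)) : Tuple M τ := fun i => z (.inr i)

theorem join_fst_snd (z : Tuple M (Sum.elim σ τ)) : join (fstTuple z) (sndTuple z) = z := by
  funext i
  rcases i with i | i <;> rfl

/-- The image of a parameter set under an automorphism. -/
def actParams (g : SortPerm M) (A : Params M) : Params M := (fun c => ⟨c.1, g c.1 c.2⟩) '' A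

theorem countable_actParams {g : SortPerm M} (hA : A.Countable) : (actParams g A).Countable :=
  hA.image _

theorem join_mem_graph_iff {R : Tuple M σ → Tuple M σ → Prop} {x y : Tuple M σ} :
    join x y ∈ graph R ↔ R x y := by
  constructor
  · rintro ⟨x', y', h, heq⟩
    have h₁ : x = x' := funext fun i => congrFun heq (.inl i)
    have h₂ : y = y' := funext fun i => congrFun heq (.inr i)
    rwa [h₁, h₂]
  · exact fun h => ⟨x, y, h, rfl⟩

end Tuples

/-! ### Definable and type-definable sets. -/

section Definable

variable {L : SortedLanguage.{u}} {M : L.Sorts → Type u} [SortedStructure L M]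
  {V : Type v} {W : Type w} {σ : V → L.Sorts} {τ : W → L.Sorts} {A B : Params M}

/-- `D` is definable with parameters from `A`. -/
def IsDefinable (A : Params M) (D : Set (Tuple M σ)) : Prop :=
  ∃ φ : ParamFormula A σ, D = {x | Sat x φ}

theorem isDefinable_setOf_sat (φ : ParamFormula A σ) : IsDefinable A {x | Sat x φ} := ⟨φ, rfl⟩

theorem isDefinable_univ : IsDefinable A (Set.univ : Set (Tuple M σ)) :=
  ⟨Formula.verum, Set.ext fun _ => iff_of_true trivial (Formula.realize_verum _)⟩

theorem IsDefinable.compl {D : Set (Tuple M σ)} (h : IsDefinable A D) : IsDefinable A Dᶜ := by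
  obtain ⟨φ, rfl⟩ := h
  exact ⟨Formula.neg φ, rfl⟩

theorem IsDefinable.inter {D D' : Set (Tuple M σ)} (h : IsDefinable A D) (h' : IsDefinable A D') :
    IsDefinable A (D ∩ D') := by
  obtain ⟨φ, rfl⟩ := h
  obtain ⟨ψ, rfl⟩ := h'
  exact ⟨Formula.and φ ψ, Set.ext fun x => (Formula.realize_and _ _ _).symm⟩

/-- `F` is given by terms with parameters from `B`. -/
def IsTermMap (B : Params M) (F : Tuple M τ → Tuple M σ) : Prop :=
  ∀ i, ∃ t : Term (Sum.elim τ fun c : B => c.1.1) (σ i),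
    ∀ x, t.eval (join x fun c : B => c.1.2) = F x i

theorem IsDefinable.preimage {D : Set (Tuple M σ)} (h : IsDefinable A D) (hAB : A ⊆ B)
    {F : Tuple M τ → Tuple M σ} (hF : IsTermMap B F) : IsDefinable B (F ⁻¹' D) := by
  obtain ⟨φ, rfl⟩ := h
  choose t ht using hF
  refine ⟨Formula.subst φ fun i => match i with
    | .inl i => t i
    | .inr c => .var (σ := Sum.elim τ fun c : B => c.1.1) (.inr ⟨c.1, hAB c.2⟩), ?_⟩
  ext x
  simp only [Set.mem_preimage, Set.mem_ofPred_eq, Sat, Formula.realize_subst]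
  refine iff_of_eq ?_
  congr 1
  funext i
  rcases i with i | c
  · exact (ht i x).symm
  · rfl

theorem isTermMap_id : IsTermMap B (id : Tuple M σ → Tuple M σ) := fun i =>
  ⟨.var (σ := Sum.elim σ fun c : B => c.1.1) (.inl i), fun _ => rfl⟩

theorem IsDefinable.mono {D : Set (Tuple M σ)} (h : IsDefinable A D) (hAB : A ⊆ B) :
    IsDefinable B D := h.preimage hAB isTermMap_id

theorem isTermMap_const {c : Tuple M σ} (hc : coords c ⊆ B) :
    IsTermMap B fun _ : Tuple M τ => c := fun i =>
  ⟨.var (σ := Sum.elim τ fun c : B => c.1.1) (.inr ⟨_, hc (mem_coords c i)⟩), fun _ => rfl⟩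

theorem IsTermMap.join {V' : Type*} {σ' : V' → L.Sorts} {F : Tuple M τ → Tuple M σ}
    {F' : Tuple M τ → Tuple M σ'} (hF : IsTermMap B F) (hF' : IsTermMap B F') :
    IsTermMap B fun x => ManySorted.join (F x) (F' x)
  | .inl i => hF i
  | .inr i => hF' i

theorem isTermMap_fst : IsTermMap B (fstTuple : Tuple M (Sum.elim σ τ) → Tuple M σ) := fun i =>
  ⟨.var (σ := Sum.elim (Sum.elim σ τ) fun c : B => c.1.1) (.inl (.inl i)), fun _ => rfl⟩

theorem isTermMap_snd : IsTermMap B (sndTuple : Tuple M (Sum.elim σ τ) → Tuple M τ) := fun i =>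
  ⟨.var (σ := Sum.elim (Sum.elim σ τ) fun c : B => c.1.1) (.inl (.inr i)), fun _ => rfl⟩

/-- Working with definable sets in place of formulas turns substitution of terms into taking
preimages. -/
theorem isTypeDefinable_iff {D : Set (Tuple M σ)} :
    IsTypeDefinable A D ↔ ∃ S : Set (Set (Tuple M σ)), (∀ D' ∈ S, IsDefinable A D') ∧ D = ⋂₀ S := by
  constructor
  · rintro ⟨p, rfl⟩
    refine ⟨(fun φ => {x | Sat x φ}) '' p, ?_, ?_⟩
    · rintro _ ⟨φ, _, rfl⟩
      exact isDefinable_setOf_sat φ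
    · ext x; simp
  · rintro ⟨S, hS, rfl⟩
    refine ⟨{φ | {x | Sat x φ} ∈ S}, ?_⟩
    ext x
    constructor
    · intro h φ hφ
      exact h _ hφ
    · intro h D hD
      obtain ⟨φ, rfl⟩ := hS D hD
      exact h φ hD

theorem IsTypeDefinable.preimage {D : Set (Tuple M σ)} (h : IsTypeDefinable A D) (hAB : A ⊆ B)
    {F : Tuple M τ → Tuple M σ} (hF : IsTermMap B F) : IsTypeDefinable B (F ⁻¹' D) := by
  rw [isTypeDefinable_iff] at *
  obtain ⟨S, hS, rfl⟩ := h
  refine ⟨(fun D => F ⁻¹' D) '' S, ?_, ?_⟩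
  · rintro _ ⟨D, hD, rfl⟩
    exact (hS D hD).preimage hAB hF
  · ext x; simp

theorem IsTypeDefinable.inter {D D' : Set (Tuple M σ)} (h : IsTypeDefinable A D)
    (h' : IsTypeDefinable A D') : IsTypeDefinable A (D ∩ D') := by
  obtain ⟨p, rfl⟩ := h
  obtain ⟨q, rfl⟩ := h'
  refine ⟨p ∪ q, Set.ext fun x => ⟨fun h φ hφ => hφ.elim (h.1 φ) (h.2 φ), fun h =>
    ⟨fun φ hφ => h φ (.inl hφ), fun φ hφ => h φ (.inr hφ)⟩⟩⟩

theorem tp_eq_iff {x y : Tuple M σ} :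
    tp A x = tp A y ↔ ∀ D, IsDefinable A D → (x ∈ D ↔ y ∈ D) := by
  constructor
  · rintro h _ ⟨φ, rfl⟩
    exact (Set.ext_iff.mp h φ)
  · intro h
    ext φ
    exact h _ (isDefinable_setOf_sat φ)

theorem tp_eq_mono {x y : Tuple M σ} (hAB : A ⊆ B) (h : tp B x = tp B y) : tp A x = tp A y := by
  rw [tp_eq_iff] at *
  exact fun D hD => h D (hD.mono hAB)

theorem IsTypeDefinable.mem_of_tp_eq {D : Set (Tuple M σ)} (hD : IsTypeDefinable A D)
    {x y : Tuple M σ} (h : tp A x = tp A y) (hx : x ∈ D) : y ∈ D := by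
  obtain ⟨S, hS, rfl⟩ := isTypeDefinable_iff.mp hD
  exact fun D' hD' => (tp_eq_iff.mp h D' (hS D' hD')).mp (hx D' hD')

theorem isTypeDefinable_setOf_tp_eq (a : Tuple M σ) : IsTypeDefinable A {x | tp A x = tp A a} := by
  refine ⟨tp A a, Set.ext fun x => ⟨fun h φ hφ => ?_, fun h => ?_⟩⟩
  · exact (Set.ext_iff.mp h φ).mpr hφ
  -- Complete types contain each formula or its negation, so an inclusion between them is an
  -- equality.
  · refine Set.Subset.antisymm (fun φ hφ => ?_) h
    by_contra hφa
    exact h (Formula.neg φ) hφa hφ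

/-- The preimage of an `∅`-definable set under an automorphism is itself. -/
theorem IsDefinable.act_mem_iff {D : Set (Tuple M σ)} (h : IsDefinable (∅ : Params M) D)
    {g : SortPerm M} (hg : g ∈ Aut M) (x : Tuple M σ) : act g x ∈ D ↔ x ∈ D := by
  obtain ⟨φ, rfl⟩ := h
  simp only [Set.mem_ofPred_eq, Sat]
  rw [← Formula.realize_act hg (join x fun c : (∅ : Params M) => c.1.2), act_join]
  refine iff_of_eq ?_
  congr 2
  exact funext fun c => c.2.elim

/-- Automorphisms move definable sets. -/
theorem IsDefinable.preimage_act {D : Set (Tuple M σ)} (h : IsDefinable A D)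
    {g : SortPerm M} (hg : g ∈ Aut M) : IsDefinable (actParams g⁻¹ A) (act g ⁻¹' D) := by
  obtain ⟨φ, rfl⟩ := h
  have hmem : ∀ c : A, (⟨c.1.1, g⁻¹ c.1.1 c.1.2⟩ : Σ s, M s) ∈ actParams g⁻¹ A :=
    fun c => ⟨c.1, c.2, rfl⟩
  refine ⟨Formula.subst φ fun i => match i with
    | .inl i => .var (σ := Sum.elim σ fun c : actParams g⁻¹ A => c.1.1) (.inl i)
    | .inr c => .var (σ := Sum.elim σ fun c : actParams g⁻¹ A => c.1.1) (.inr ⟨_, hmem c⟩), ?_⟩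
  ext x
  simp only [Set.mem_preimage, Set.mem_ofPred_eq, Sat, Formula.realize_subst]
  refine Iff.trans (iff_of_eq ?_) (Formula.realize_act hg _ φ)
  congr 1
  funext i
  rcases i with i | c
  · rfl
  · exact (Equiv.apply_symm_apply (g c.1.1) c.1.2).symm

end Definable

/-! ### Realising ultrafilters by saturation. -/

section Saturation

variable {L : SortedLanguage.{u}} {M : L.Sorts → Type u} [SortedStructure L M]
  {V : Type u} {σ : V → L.Sorts} {A B : Params M} {κ : Cardinal.{u}}

/-- In a saturated structure, every ultrafilter on tuples is realised over every small set. -/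
theorem IsSaturated.exists_realization (hM : IsSaturated L M κ) (hV : Cardinal.mk V < κ)
    (hA : Cardinal.mk A < κ) (𝒰 : Ultrafilter (Tuple M σ)) :
    ∃ z, ∀ D, IsDefinable A D → (z ∈ D ↔ D ∈ 𝒰) := by
  obtain ⟨z, hz⟩ := hM V σ A hV hA {φ | {x | Sat x φ} ∈ 𝒰} (by
    intro q hq hqp
    have : (⋂ φ ∈ q, {x : Tuple M σ | Sat x φ}) ∈ 𝒰 :=
      (Filter.biInter_mem hq).mpr fun φ hφ => hqp hφ
    obtain ⟨x, hx⟩ := 𝒰.nonempty_of_mem this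
    exact ⟨x, by simpa using hx⟩)
  have key : ∀ D, IsDefinable A D → D ∈ 𝒰 → z ∈ D := by
    rintro _ ⟨φ, rfl⟩ h
    exact hz φ h
  refine ⟨z, fun D hD => ⟨fun h => ?_, key D hD⟩⟩
  by_contra h'
  exact key _ hD.compl (Ultrafilter.compl_mem_iff_notMem.mpr h') h

/-- Each definable set containing `D` lies in the filter, hence contains `z`. There is no converse:
`D` may contain `z` without belonging to the filter. -/
theorem IsTypeDefinable.mem_of_realizes {V : Type v} {σ : V → L.Sorts} {D : Set (Tuple M σ)}
    (hD : IsTypeDefinable B D)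
    {𝒰 : Filter (Tuple M σ)} {z : Tuple M σ} (hz : ∀ D, IsDefinable A D → (z ∈ D ↔ D ∈ 𝒰))
    (hBA : B ⊆ A) (h : D ∈ 𝒰) : z ∈ D := by
  obtain ⟨S, hS, rfl⟩ := isTypeDefinable_iff.mp hD
  exact fun D' hD' => (hz D' ((hS D' hD').mono hBA)).mpr
    (Filter.mem_of_superset h (Set.sInter_subset_of_mem hD'))

/-- Finite satisfiability of a type by elements of a set gives an ultrafilter. -/
theorem exists_ultrafilter_tp {V : Type v} {σ : V → L.Sorts} (x : Tuple M σ) (C : Set (Tuple M σ))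
    (h : ∀ D, IsDefinable A D → x ∈ D → (D ∩ C).Nonempty) :
    ∃ 𝒰 : Ultrafilter (Tuple M σ), C ∈ 𝒰 ∧ ∀ D, IsDefinable A D → (x ∈ D ↔ D ∈ 𝒰) := by
  let I := {D : Set (Tuple M σ) // IsDefinable A D ∧ x ∈ D}
  let f : Filter (Tuple M σ) := ⨅ D : I, Filter.principal (D.1 ∩ C)
  have : Nonempty I := ⟨⟨Set.univ, isDefinable_univ, trivial⟩⟩
  have hf : f.NeBot := by
    refine Filter.iInf_neBot_of_directed' ?_ fun D =>
      Filter.principal_neBot_iff.mpr (h _ D.2.1 D.2.2)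
    intro D D'
    refine ⟨⟨D.1 ∩ D'.1, D.2.1.inter D'.2.1, D.2.2, D'.2.2⟩, ?_, ?_⟩
    · exact Filter.principal_mono.mpr fun y hy => ⟨hy.1.1, hy.2⟩
    · exact Filter.principal_mono.mpr fun y hy => ⟨hy.1.2, hy.2⟩
  have hle : ∀ D : I, D.1 ∩ C ∈ Ultrafilter.of f := fun D =>
    Ultrafilter.of_le f (Filter.mem_iInf_of_mem D (Filter.mem_principal_self _))
  have key : ∀ D, IsDefinable A D → x ∈ D → D ∈ Ultrafilter.of f := fun D hD hx =>
    Filter.mem_of_superset (hle ⟨D, hD, hx⟩) Set.inter_subset_left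
  refine ⟨Ultrafilter.of f, Filter.mem_of_superset (hle (Classical.arbitrary I))
    Set.inter_subset_right, fun D hD => ⟨key D hD, fun h' => ?_⟩⟩
  by_contra hx
  exact Ultrafilter.compl_mem_iff_notMem.mp (key _ hD.compl hx) h'

end Saturation

/-! ### Countable elementary substructures. -/

section Models

variable {L : SortedLanguage.{u}} {M : L.Sorts → Type u}

theorem join_val {V : Type v} {W : Type w} {σ : V → L.Sorts} {τ : W → L.Sorts} {N : Params M}
    (x : Tuple (carrier N) σ) (y : Tuple (carrier N) τ) :
    (fun i => (join x y i).1 : Tuple M (Sum.elim σ τ)) =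
      join (fun i => (x i).1) fun i => (y i).1 := by
  funext i
  rcases i with i | i <;> rfl

theorem consTuple_val {s : L.Sorts} {l : List L.Sorts} {N : Params M} (m : carrier N s)
    (y : Tuple (carrier N) l.get) :
    (fun i => (consTuple m y i).1 : Tuple M (s :: l).get) = consTuple m.1 fun i => (y i).1 := by
  funext k
  refine Fin.cases ?_ (fun k => ?_) k <;> rfl

variable [SortedStructure L M]

theorem Term.eval_val {V : Type v} {σ : V → L.Sorts} {N : Params M} (h : IsFuncClosed N)
    (x : Tuple (carrier N) σ) {s : L.Sorts} (t : Term σ s) :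
    (@Term.eval L (carrier N) (inducedStructure N h) V σ x s t).1 =
      t.eval (M := M) fun i => (x i).1 := by
  induction t with
  | var v => rfl
  | func f ts ih =>
    exact congrArg (SortedStructure.funMap f) (funext ih)

/-- The Tarski–Vaught test. -/
theorem isElementary_of_witnesses {N : Params M} (h : IsFuncClosed N)
    (hw : ∀ (n : ℕ) (σ : Fin n → L.Sorts) (l : List L.Sorts) (s : L.Sorts) (φ : BFormula σ (s :: l))
      (x : Tuple (carrier N) σ) (y : Tuple (carrier N) l.get),
      (∃ m : M s, ¬ φ.Holds (fun i => (x i).1) (consTuple m fun i => (y i).1)) →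
      ∃ m : carrier N s, ¬ φ.Holds (fun i => (x i).1) (consTuple m.1 fun i => (y i).1)) :
    IsElementary N := by
  refine ⟨h, fun n σ φ x => ?_⟩
  have key : ∀ {l : List L.Sorts} (φ : BFormula σ l) (y : Tuple (carrier N) l.get),
      @BFormula.Holds L (carrier N) (inducedStructure N h) _ σ x l φ y ↔
        φ.Holds (fun i => (x i).1) fun i => (y i).1 := by
    intro l φ
    induction φ with
    | falsum => exact fun y => Iff.rfl
    | equal t₁ t₂ =>
      intro y
      simp only [BFormula.Holds, ← join_val, ← Term.eval_val h]
      exact Subtype.ext_iff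
    | rel R ts =>
      intro y
      simp only [BFormula.Holds, ← join_val, ← Term.eval_val h]
      exact Iff.rfl
    | imp φ ψ ih₁ ih₂ =>
      intro y
      simp only [BFormula.Holds, ih₁, ih₂]
    | @all l s φ ih =>
      intro y
      simp only [BFormula.Holds, ih, consTuple_val]
      refine ⟨fun H => ?_, fun H m => H m.1⟩
      by_contra hcon
      obtain ⟨m, hm⟩ := hw n σ l s φ x y (not_forall.mp hcon)
      exact hm (H m)
  unfold Formula.Realize
  rw [key]
  refine iff_of_eq ?_
  congr 1
  exact funext fun k => k.elim0

/-- The downward Löwenheim–Skolem theorem for countable languages. -/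
theorem exists_isCountableModel [hL : L.IsCountable] : ∃ N : Params M, IsCountableModel N := by
  classical
  have := hL.sorts
  have := hL.func
  have := fun (n : ℕ) (σ : Fin n → L.Sorts) l => BFormula.countable σ l
  -- `I A` indexes the Tarski–Vaught conditions over `A`, and `J A` the function values at tuples
  -- from `A`. One step `S` adds a witness for each satisfiable condition and all these values.
  let I : Params M → Type u := fun A => Σ (n : ℕ) (σ : Fin n → L.Sorts) (l : List L.Sorts)
    (s : L.Sorts), BFormula σ (s :: l) × Tuple (carrier A) σ × Tuple (carrier A) l.get
  let J : Params M → Type u := fun A => Σ (a : List L.Sorts) (s : L.Sorts),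
    L.Func a s × Tuple (carrier A) a.get
  let P : ∀ A, ∀ i : I A, M i.2.2.2.1 → Prop := fun A i m =>
    ¬ i.2.2.2.2.1.Holds (fun k => (i.2.2.2.2.2.1 k).1) (consTuple m fun k => (i.2.2.2.2.2.2 k).1)
  let S : Params M → Params M := fun A => A ∪
    (⋃ i : I A, {c | ∃ h : ∃ m, P A i m, c = ⟨_, h.choose⟩}) ∪
    Set.range fun j : J A => ⟨j.2.1, SortedStructure.funMap j.2.2.1 fun k => (j.2.2.2 k).1⟩
  have hS : ∀ A : Params M, A.Countable → (S A).Countable := by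
    intro A hA
    have : Countable A := hA.to_subtype
    have hc : ∀ s, Countable (carrier A s) := fun s =>
      Function.Injective.countable (f := fun x : carrier A s => (⟨⟨s, x.1⟩, x.2⟩ : A)) (by
        rintro ⟨x, hx⟩ ⟨y, hy⟩ h
        simpa using h)
    have hT : ∀ {n : ℕ} (σ : Fin n → L.Sorts), Countable (Tuple (carrier A) σ) :=
      fun σ => inferInstance
    have : Countable (I A) := inferInstance
    have : Countable (J A) := inferInstance
    refine (hA.union (Set.countable_iUnion fun i => Set.Subsingleton.countable ?_)).union
      (Set.countable_range _)
    rintro _ ⟨_, rfl⟩ _ ⟨_, rfl⟩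
    rfl
  let C : ℕ → Params M := fun n => Nat.rec ∅ (fun _ A => S A) n
  have hC : ∀ n, (C n).Countable := by
    intro n
    induction n with
    | zero => exact Set.countable_empty
    | succ n ih => exact hS _ ih
  have hmono : Monotone C := monotone_nat_of_le_succ fun n x hx => .inl (.inl hx)
  have hlift : ∀ {n : ℕ} {σ : Fin n → L.Sorts} (x : Tuple (carrier (⋃ n, C n)) σ),
      ∃ m, ∀ m' ≥ m, ∀ k, (⟨σ k, (x k).1⟩ : Σ s, M s) ∈ C m' := by
    intro n σ x
    choose m hm using fun k => Set.mem_iUnion.mp (x k).2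
    exact ⟨Finset.univ.sup m, fun m' hm' k =>
      hmono ((Finset.le_sup (Finset.mem_univ k)).trans hm') (hm k)⟩
  have hcl : IsFuncClosed (⋃ n, C n) := by
    intro a s f x hx
    obtain ⟨m, hm⟩ := hlift (fun k => ⟨x k, hx k⟩ : Tuple (carrier (⋃ n, C n)) a.get)
    exact Set.mem_iUnion.mpr ⟨m + 1, .inr ⟨⟨a, s, f, fun k => ⟨x k, hm m le_rfl k⟩⟩, rfl⟩⟩
  refine ⟨⋃ n, C n, Set.countable_iUnion hC, isElementary_of_witnesses hcl ?_⟩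
  intro n σ l s φ x y hex
  obtain ⟨m₁, h₁⟩ := hlift x
  obtain ⟨m₂, h₂⟩ := hlift y
  let m := max m₁ m₂
  let i : I (C m) := ⟨n, σ, l, s, φ, fun k => ⟨(x k).1, h₁ m (le_max_left _ _) k⟩,
    fun k => ⟨(y k).1, h₂ m (le_max_right _ _) k⟩⟩
  have hi : ∃ a, P (C m) i a := hex
  exact ⟨⟨hi.choose, Set.mem_iUnion.mpr ⟨m + 1, .inl (.inr (Set.mem_iUnion.mpr
    ⟨i, hi, rfl⟩))⟩⟩, hi.choose_spec⟩

/-- A formula involves finitely many variables, so elementarity for variables indexed by `Fin n`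
extends to arbitrary index types. -/
theorem IsElementary.realize_iff {N : Params M} (hN : IsElementary N) :
    ∃ h : IsFuncClosed N, ∀ {V : Type v} {σ : V → L.Sorts} (φ : Formula σ)
      (x : Tuple (carrier N) σ), @Formula.Realize L (carrier N) (inducedStructure N h) _ σ φ x ↔
        Formula.Realize (M := M) φ fun i => (x i).1 := by
  obtain ⟨h, hN⟩ := hN
  refine ⟨h, fun {V σ} φ x => ?_⟩
  obtain ⟨F, hF⟩ := BFormula.exists_support φ
  obtain ⟨φ', hφ'⟩ := hF F subset_rfl
  let e := F.equivFin.symm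
  have ht : ∀ v : F, ∃ t : Term (fun k => σ (e k)) (σ v), ∀ (M : L.Sorts → Type u)
      [SortedStructure L M] (x : Tuple M σ), t.eval (fun k => x (e k)) = x v := by
    intro v
    obtain ⟨k, rfl⟩ := e.surjective v
    exact ⟨.var (σ := fun k => σ (e k)) k, fun M _ x => rfl⟩
  choose t ht using ht
  have key : ∀ (M : L.Sorts → Type u) [SortedStructure L M] (x : Tuple M σ),
      Formula.Realize φ x ↔
        Formula.Realize (Formula.subst (φ' : Formula fun v : F => σ v) t) fun k => x (e k) := by
    intro M _ x
    rw [Formula.realize_subst]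
    simp only [ht]
    exact (hφ' M x _).symm
  exact (@key (carrier N) (inducedStructure N h) x).trans ((hN _ _ _ _).trans (key M fun i => (x i).1).symm)

/-- Formulas over a model that are satisfiable are satisfiable in the model. -/
theorem IsElementary.exists_mem_sat {V : Type v} {σ : V → L.Sorts} {N : Params M}
    (hN : IsElementary N) (φ : ParamFormula N σ) (x : Tuple M σ) (hx : Sat x φ) :
    ∃ z : Tuple M σ, Sat z φ ∧ ∀ i, (⟨σ i, z i⟩ : Σ s, M s) ∈ N := by
  classical
  obtain ⟨h, hN'⟩ := IsElementary.realize_iff.{u, max u v} hN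
  -- Coordinates that `φ` does not mention still need values in `N`; the sentence saying that the
  -- sort is nonempty transfers to `N`.
  have hz₀ : ∀ i : V, Nonempty (carrier N (σ i)) := by
    intro i
    let χ : Formula (fun k : Fin 0 => (k.elim0 : L.Sorts)) :=
      .imp (.all (s := σ i) .falsum) .falsum
    have hχ : Formula.Realize (M := M) χ fun k => k.elim0 := fun H => H (x i)
    by_contra hne
    obtain ⟨h₀, hN₀⟩ := hN
    refine (hN₀ 0 _ χ fun k => k.elim0).mpr ?_ fun m => hne ⟨m⟩
    convert hχ using 1
  let z₀ : Tuple (carrier N) σ := fun i => Classical.choice (hz₀ i)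
  let p₀ : Tuple (carrier N) fun c : N => c.1.1 := fun c => ⟨c.1.2, c.2⟩
  obtain ⟨F, hF⟩ := Formula.exists_finset_congr φ
  -- Only the object variables occurring in `φ` are quantified out; the parameters from `N` keep
  -- their values.
  let l := (F.filter fun i => i.isLeft).toList
  have hψ : (Formula.exList l φ).Realize fun i => (join z₀ p₀ i).1 := by
    rw [Formula.realize_exList]
    refine ⟨join (fun i => if Sum.inl i ∈ l then x i else (z₀ i).1) fun c => c.1.2, ?_, ?_⟩
    · rintro (i | c) hi
      · exact if_neg hi
      · rfl
    · refine (hF M _ _ ?_).mp hx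
      rintro (i | c) hi
      · exact (if_pos (by simpa [l] using hi)).symm
      · rfl
  let := inducedStructure N h
  rw [← hN', Formula.realize_exList] at hψ
  obtain ⟨x', hx', hφ⟩ := hψ
  rw [hN'] at hφ
  refine ⟨fun i => (x' (.inl i)).1, ?_, fun i => (x' (.inl i)).2⟩
  unfold Sat
  convert hφ using 1
  funext i
  rcases i with i | c
  · rfl
  · rw [hx' (.inr c) (by simp [l])]
    rfl

end Models

/-! ### Bounded invariant relations and types over models. -/

section Bounded

variable {L : SortedLanguage.{u}} {M : L.Sorts → Type u} [SortedStructure L M]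
  {κ : Cardinal.{u}} {ι : Type u} [Countable ι] {σ : ι → L.Sorts}

theorem mk_lt_of_countable (hκ : Cardinal.continuum.{u} < κ) {α : Type u} {A : Set α}
    (hA : A.Countable) : Cardinal.mk A < κ :=
  ((Cardinal.le_aleph0_iff_set_countable.mpr hA).trans_lt Cardinal.aleph0_lt_continuum).trans hκ

theorem mk_index_lt (hκ : Cardinal.continuum.{u} < κ) (ι : Type u) [Countable ι] :
    Cardinal.mk ι < κ :=
  (Cardinal.mk_le_aleph0.trans_lt Cardinal.aleph0_lt_continuum).trans hκ

theorem mk_union_lt (hκ : Cardinal.continuum.{u} < κ) {α : Type u} {A B : Set α}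
    (hA : Cardinal.mk A < κ) (hB : Cardinal.mk B < κ) : Cardinal.mk (A ∪ B : Set α) < κ :=
  (Cardinal.mk_union_le A B).trans_lt
    (Cardinal.add_lt_of_lt (Cardinal.aleph0_le_continuum.trans hκ.le) hA hB)

/-- An invariant relation depends only on the types of pairs. -/
theorem IsInvariant.of_tp_eq (hκ : Cardinal.continuum.{u} < κ) (hM : IsMonster L M κ)
    {E : Tuple M σ → Tuple M σ → Prop} (hinv : IsInvariant E) {x y x' y' : Tuple M σ}
    (h : tp (∅ : Params M) (join x y) = tp ∅ (join x' y')) (hE : E x y) : E x' y' := by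
  obtain ⟨g, hg, hgx⟩ := hM.homogeneous (ι ⊕ ι) _ (mk_index_lt hκ _) _ _ h
  rw [act_join] at hgx
  have h₁ : act g x = x' := funext fun i => congrFun hgx (.inl i)
  have h₂ : act g y = y' := funext fun i => congrFun hgx (.inr i)
  rw [← h₁, ← h₂]
  exact (hinv g hg x y).mpr hE

/-- A bounded invariant equivalence relation is coarser than equality of types over a model. -/
theorem IsBounded.rel_of_tp_eq (hκ : Cardinal.continuum.{u} < κ) (hM : IsMonster L M κ)
    {X : Set (Tuple M σ)} (hX : IsTypeDefinable ∅ X) {E : Tuple M σ → Tuple M σ → Prop}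
    (hE : IsEquivOn X E) (hinv : IsInvariant E) (hbdd : IsBounded κ X E)
    {N : Params M} (hN : IsCountableModel N) {x y : Tuple M σ} (hx : x ∈ X)
    (hxy : tp N x = tp N y) : E x y := by
  classical
  -- A coheir: the type of `x` over the model is finitely satisfiable in it. Since `𝒰` lives on
  -- tuples from `N`, the type of a pair `(c, b)` with `c` realising `𝒰` over `b` depends only on
  -- the type of `b` over `N`.
  obtain ⟨𝒰, hN𝒰, h𝒰⟩ := exists_ultrafilter_tp x {z | ∀ i, (⟨σ i, z i⟩ : Σ s, M s) ∈ N} (by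
    rintro _ ⟨φ, rfl⟩ hφ
    exact hN.2.exists_mem_sat φ x hφ)
  have hinvar : ∀ {b b' : Tuple M σ}, tp N b = tp N b' → ∀ D : Set (Tuple M (Sum.elim σ σ)),
      IsDefinable ∅ D → ({z | join z b ∈ D} ∈ 𝒰 ↔ {z | join z b' ∈ D} ∈ 𝒰) := by
    intro b b' hb D hD
    refine Filter.eventually_congr ?_
    filter_upwards [hN𝒰] with z hz
    refine tp_eq_iff.mp hb {w | join z w ∈ D} (hD.preimage (Set.empty_subset _)
      ((isTermMap_const ?_).join isTermMap_id))
    rintro _ ⟨i, rfl⟩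
    exact hz i
  have hpair : ∀ {B B' : Params M} {b b' c c' : Tuple M σ}, tp N b = tp N b' →
      coords b ⊆ B → coords b' ⊆ B' → (∀ D, IsDefinable B D → (c ∈ D ↔ D ∈ 𝒰)) →
      (∀ D, IsDefinable B' D → (c' ∈ D ↔ D ∈ 𝒰)) →
      tp (∅ : Params M) (join c b) = tp ∅ (join c' b') := by
    intro B B' b b' c c' hb hbB hbB' hc hc'
    refine tp_eq_iff.mpr fun D hD => ?_
    refine (hc {z | join z b ∈ D} (hD.preimage (Set.empty_subset _)
      (isTermMap_id.join (isTermMap_const hbB)))).trans ((hinvar hb D hD).trans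
      (hc' {z | join z b' ∈ D} (hD.preimage (Set.empty_subset _)
      (isTermMap_id.join (isTermMap_const hbB')))).symm)
  let Q := {C : Set (Tuple M σ) // ∃ x ∈ X, C = classOf E x}
  -- A representative, with the type of `x` over `N`, of every class containing such an element; the
  -- default `x` keeps this type for the remaining classes.
  let s : Q → Tuple M σ := fun C =>
    if h : ∃ z ∈ C.1, tp N z = tp N x then h.choose else x
  have hs : ∀ C, tp N (s C) = tp N x := by
    intro C
    by_cases h : ∃ z ∈ C.1, tp N z = tp N x
    · simp only [s, dif_pos h]
      exact h.choose_spec.2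
    · simp only [s, dif_neg h]
  let R : Params M := Set.range fun q : Q × ι => ⟨σ q.2, s q.1 q.2⟩
  have hR : Cardinal.mk R < κ := by
    refine Cardinal.mk_range_le.trans_lt ?_
    rw [Cardinal.mk_prod, Cardinal.lift_id, Cardinal.lift_id]
    exact Cardinal.mul_lt_of_lt (Cardinal.aleph0_le_continuum.trans hκ.le) hbdd (mk_index_lt hκ ι)
  have hNκ := mk_lt_of_countable hκ hN.1
  -- Boundedness makes the set of representatives small, so `c` can realise `𝒰` over all of them and
  -- is nevertheless equivalent to one of them.
  obtain ⟨c, hc⟩ := hM.saturated.exists_realization (mk_index_lt hκ ι) (mk_union_lt hκ hNκ hR) 𝒰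
  have hcx : tp N c = tp N x := tp_eq_iff.mpr fun D hD =>
    (hc D (hD.mono Set.subset_union_left)).trans (h𝒰 D hD).symm
  have hcX : c ∈ X := hX.mem_of_tp_eq (tp_eq_mono (Set.empty_subset _) hcx.symm) hx
  let C₀ : Q := ⟨classOf E c, c, hcX, rfl⟩
  have hcs : E c (s C₀) := by
    have h : ∃ z ∈ C₀.1, tp N z = tp N x := ⟨c, hE.refl c hcX, hcx⟩
    simp only [s, dif_pos h]
    exact h.choose_spec.1
  obtain ⟨c', hc'⟩ := hM.saturated.exists_realization (mk_index_lt hκ ι)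
    (mk_lt_of_countable hκ (hN.1.union ((countable_coords x).union (countable_coords y)))) 𝒰
  have hsR : coords (s C₀) ⊆ N ∪ R := by
    rintro _ ⟨i, rfl⟩
    exact .inr ⟨⟨C₀, i⟩, rfl⟩
  -- `s C₀`, `x` and `y` have one type over `N`, so the equivalence of `c` with `s C₀` transfers to
  -- `(c', x)` and `(c', y)`.
  have h₁ : E c' x := hinv.of_tp_eq hκ hM
    (hpair (hs C₀) hsR (fun _ h => .inr (.inl h)) hc hc') hcs
  have h₂ : E c' y := hinv.of_tp_eq hκ hM
    (hpair ((hs C₀).trans hxy) hsR (fun _ h => .inr (.inr h)) hc hc') hcs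
  exact hE.trans _ _ _ (hE.symm _ _ h₁) h₂

end Bounded

/-! ### Distance and diameter of a normal form. -/

section NormalForm

variable {L : SortedLanguage.{u}} {M : L.Sorts → Type u} [SortedStructure L M]
  {V : Type v} {σ : V → L.Sorts} {X : Set (Tuple M σ)} {E : Tuple M σ → Tuple M σ → Prop}
  {Φ : ℕ → Set (ParamFormula (∅ : Params M) (Sum.elim σ σ))}

theorem isTypeDefinable_holdsAt (n : ℕ) :
    IsTypeDefinable (∅ : Params M) {z | HoldsAt Φ n (fstTuple z) (sndTuple z)} := by
  refine ⟨Φ n, ?_⟩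
  ext z
  simp only [HoldsAt, join_fst_snd]

theorem isTypeDefinable_holdsAt_right (n : ℕ) (c : Tuple M σ) :
    IsTypeDefinable (coords c) {y | HoldsAt Φ n c y} :=
  (isTypeDefinable_holdsAt n).preimage (Set.empty_subset _)
    ((isTermMap_const subset_rfl).join isTermMap_id)

theorem holdsAt_act {g : SortPerm M} (hg : g ∈ Aut M) (n : ℕ) (x y : Tuple M σ) :
    HoldsAt Φ n (act g x) (act g y) ↔ HoldsAt Φ n x y := by
  unfold HoldsAt
  refine forall₂_congr fun φ _ => ?_
  rw [← act_join]
  exact (isDefinable_setOf_sat φ).act_mem_iff hg (join x y)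

namespace IsNormalForm

theorem holdsAt_mono (hΦ : IsNormalForm X E Φ) {m n : ℕ} (hmn : m ≤ n) {x y : Tuple M σ}
    (h : HoldsAt Φ m x y) : HoldsAt Φ n x y := by
  induction hmn with
  | refl => exact h
  | step _ ih => exact hΦ.mono _ _ _ ih

theorem dist_le_iff (hΦ : IsNormalForm X E Φ) {n : ℕ} {x y : Tuple M σ} :
    dist Φ x y ≤ n ↔ HoldsAt Φ n x y := by
  constructor
  · intro h
    -- Only a strict bound on an infimum yields a witness, hence the passage to `n + 1`.
    have h' : dist Φ x y < (n + 1 : ℕ) := h.trans_lt (by exact_mod_cast Nat.lt_succ_self n)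
    unfold dist at h'
    simp only [iInf_lt_iff] at h'
    obtain ⟨m, hm, hmn⟩ := h'
    exact hΦ.holdsAt_mono (Nat.lt_succ_iff.mp (by exact_mod_cast hmn)) hm
  · exact fun h => iInf₂_le n h

theorem holdsAt_symm (hΦ : IsNormalForm X E Φ) {n : ℕ} {x y : Tuple M σ} (hx : x ∈ X)
    (hy : y ∈ X) (h : HoldsAt Φ n x y) : HoldsAt Φ n y x := by
  rw [← hΦ.dist_le_iff] at *
  rwa [hΦ.dist_comm y hy x hx]

theorem holdsAt_trans (hΦ : IsNormalForm X E Φ) {m n : ℕ} {x y z : Tuple M σ} (hx : x ∈ X)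
    (hy : y ∈ X) (hz : z ∈ X) (h : HoldsAt Φ m x y) (h' : HoldsAt Φ n y z) :
    HoldsAt Φ (m + n) x z := by
  rw [← hΦ.dist_le_iff] at *
  push_cast
  exact (hΦ.dist_triangle x hx y hy z hz).trans (add_le_add h h')

theorem diam_lt_top_iff (hΦ : IsNormalForm X E Φ) (C : Set (Tuple M σ)) :
    diam Φ C < ⊤ ↔ ∃ n, ∀ x ∈ C, ∀ y ∈ C, HoldsAt Φ n x y := by
  constructor
  · intro h
    obtain ⟨n, hn⟩ := ENat.ne_top_iff_exists.mp h.ne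
    refine ⟨n, fun x hx y hy => hΦ.dist_le_iff.mp ?_⟩
    rw [hn]
    exact le_iSup₂_of_le x hx (le_iSup₂_of_le y hy le_rfl)
  · rintro ⟨n, hn⟩
    refine lt_of_le_of_lt ?_ (ENat.natCast_lt_top n)
    exact iSup₂_le fun x hx => iSup₂_le fun y hy => hΦ.dist_le_iff.mpr (hn x hx y hy)

end IsNormalForm

end NormalForm

/-! ### Transfer of diameter bounds by automorphisms. -/

section Homogeneity

variable {L : SortedLanguage.{u}} {M : L.Sorts → Type u} [SortedStructure L M]
  {κ : Cardinal.{u}} {ι : Type u} [Countable ι] {σ : ι → L.Sorts} {X : Set (Tuple M σ)}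
  {E : Tuple M σ → Tuple M σ → Prop}
  {Φ : ℕ → Set (ParamFormula (∅ : Params M) (Sum.elim σ σ))}

/-- Classes of conjugate elements have the same diameter bounds. -/
theorem holdsAt_classOf_of_mem_typeClass (hκ : Cardinal.continuum.{u} < κ) (hM : IsMonster L M κ)
    (hinv : IsInvariant E) {a b : Tuple M σ} (hb : b ∈ typeClass a) {n : ℕ}
    (h : ∀ x ∈ classOf E a, ∀ y ∈ classOf E a, HoldsAt Φ n x y) :
    ∀ x ∈ classOf E b, ∀ y ∈ classOf E b, HoldsAt Φ n x y := by
  obtain ⟨g, hg, rfl⟩ := hM.homogeneous ι σ (mk_index_lt hκ ι) b a hb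
  have hmem : ∀ x ∈ classOf E b, act g x ∈ classOf E (act g b) := fun x hx => (hinv g hg b x).mpr hx
  intro x hx y hy
  exact (holdsAt_act hg n x y).mp (h _ (hmem x hx) _ (hmem y hy))

end Homogeneity

/-! ### Automorphisms acting on ultrafilters, and closed balls. -/

section UltrafilterAction

open Topology

variable {L : SortedLanguage.{u}} {M : L.Sorts → Type u} {V : Type v} {σ : V → L.Sorts}

/-- The action of a group of families of permutations on ultrafilters on a product of sorts. -/
@[reducible]
def ultrafilterAction (Γ : Subgroup (SortPerm M)) (σ : V → L.Sorts) :
    MulAction Γ (Ultrafilter (Tuple M σ)) where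
  smul g 𝒰 := 𝒰.map (act g.1)
  one_smul 𝒰 := Ultrafilter.map_id 𝒰
  mul_smul g h 𝒰 := (Ultrafilter.map_map 𝒰 (act h.1) (act g.1)).symm

theorem continuousConstSMul_ultrafilter (Γ : Subgroup (SortPerm M)) :
    letI := ultrafilterAction Γ σ
    ContinuousConstSMul Γ (Ultrafilter (Tuple M σ)) := by
  let := ultrafilterAction Γ σ
  refine ⟨fun g => ?_⟩
  refine ultrafilterBasis_is_basis.continuous_iff.mpr ?_
  rintro _ ⟨s, rfl⟩
  exact ultrafilter_isOpen_basic (act g.1 ⁻¹' s)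

variable [SortedStructure L M]

/-- If `y` realises an ultrafilter over a set, then its image under an automorphism realises the
image of the ultrafilter over the image of the set. -/
theorem realizes_map_act {g : SortPerm M} (hg : g ∈ Aut M) {𝒰 : Ultrafilter (Tuple M σ)}
    {A B : Params M} (hB : actParams g⁻¹ B ⊆ A) {y : Tuple M σ}
    (hy : ∀ D, IsDefinable A D → (y ∈ D ↔ D ∈ 𝒰)) :
    ∀ D, IsDefinable B D → (act g y ∈ D ↔ D ∈ 𝒰.map (act g)) := fun D hD =>
  hy (act g ⁻¹' D) ((hD.preimage_act hg).mono hB)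

variable (Φ : ℕ → Set (ParamFormula (∅ : Params M) (Sum.elim σ σ)))

/-- The ultrafilters concentrated on elements at distance at most `n` from `c`. -/
def ultrafilterBall (n : ℕ) (c : Tuple M σ) : Set (Ultrafilter (Tuple M σ)) :=
  {𝒰 | ∀ D, IsDefinable (coords c) D → {y | HoldsAt Φ n c y} ⊆ D → D ∈ 𝒰}

theorem isClosed_ultrafilterBall (n : ℕ) (c : Tuple M σ) : IsClosed (ultrafilterBall Φ n c) := by
  have : ultrafilterBall Φ n c = ⋂ (D : Set (Tuple M σ)) (_ : IsDefinable (coords c) D)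
      (_ : {y | HoldsAt Φ n c y} ⊆ D), {𝒰 | D ∈ 𝒰} := by
    ext; simp [ultrafilterBall]
  rw [this]
  exact isClosed_iInter fun D => isClosed_iInter fun _ => isClosed_iInter fun _ =>
    ultrafilter_isClosed_basic D

variable {Φ}

/-- The ball is an intersection of sets definable over `c`, so testing definable supersets detects
whether a realisation lies in it. The ball itself need not belong to `𝒰`. -/
theorem mem_ultrafilterBall_iff {n : ℕ} {c y : Tuple M σ} {𝒰 : Ultrafilter (Tuple M σ)}
    {A : Params M} (hA : coords c ⊆ A) (hy : ∀ D, IsDefinable A D → (y ∈ D ↔ D ∈ 𝒰)) :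
    𝒰 ∈ ultrafilterBall Φ n c ↔ HoldsAt Φ n c y := by
  constructor
  · intro h
    obtain ⟨S, hS, hS'⟩ := isTypeDefinable_iff.mp (isTypeDefinable_holdsAt_right (Φ := Φ) n c)
    have : y ∈ {y | HoldsAt Φ n c y} := by
      rw [hS']
      intro D hD
      refine (hy D ((hS D hD).mono hA)).mpr (h D (hS D hD) ?_)
      rw [hS']
      exact Set.sInter_subset_of_mem hD
    exact this
  · exact fun h D hD hD' => (hy D (hD.mono hA)).mp (hD' h)

end UltrafilterAction

/-! ### Smoothness, finite diameter and type-definability. -/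

section Smooth

open Topology Filter

variable {L : SortedLanguage.{u}} {M : L.Sorts → Type u} [SortedStructure L M]
  {κ : Cardinal.{u}} {ι : Type u} [Countable ι] {σ : ι → L.Sorts} {X Y : Set (Tuple M σ)}
  {E : Tuple M σ → Tuple M σ → Prop} {a : Tuple M σ} {N : Params M}
  {Φ : ℕ → Set (ParamFormula (∅ : Params M) (Sum.elim σ σ))}

/-- If the relation is smooth on a pseudo-closed saturated set of elements of the same type and is
orbital on types, then its classes there have finite diameter. -/
theorem IsSmoothOver.diam_lt_top (hκ : Cardinal.continuum.{u} < κ) (hM : IsMonster L M κ)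
    (hX : IsTypeDefinable ∅ X) (hE : IsEquivOn X E) (hinv : IsInvariant E)
    (hbdd : IsBounded κ X E) (horb : IsOrbitalOnTypes X E) (ha : a ∈ X) (hYa : Y ⊆ typeClass a)
    (hYsat : IsSaturatedFor E Y) (hYpc : IsPseudoClosed κ Y) (haY : a ∈ Y)
    (hΦ : IsNormalForm X E Φ) (hN : IsCountableModel N) (hsm : IsSmoothOver N E Y) :
    diam Φ (classOf E a) < ⊤ := by
  obtain ⟨Γ, hΓ, hpres, htrans⟩ := horb.2 a
  have hYX : Y ⊆ X := fun y hy => hX.mem_of_tp_eq (hYa hy).symm ha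
  have hE_act : ∀ g ∈ Γ, ∀ y ∈ Y, E y (act g y) := by
    intro g hg y hy
    have hmem : act g y ∈ act g '' classOf (restrictTo E (typeClass a)) y :=
      ⟨y, ⟨hE.refl y (hYX hy), hYa hy, hYa hy⟩, rfl⟩
    rw [hpres g hg y ⟨hYX hy, hYa hy⟩] at hmem
    exact hmem.1
  have hY_act : ∀ g ∈ Γ, ∀ y ∈ Y, act g y ∈ Y := fun g hg y hy =>
    hYsat y _ hy (hE_act g hg y hy)
  have hEY : ∀ {x y}, E x y → x ∈ Y → y ∈ Y := fun {x y} h hx => hYsat x y hx h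
  by_contra hdiam
  -- By transitivity, a `Γ`-orbit inside a ball of radius `n` would give its class diameter at most
  -- `2n`, and the class of `a` is conjugate to it.
  have hunb : ∀ c ∈ Y, ∀ n : ℕ, ∃ g ∈ Γ, ¬ HoldsAt Φ n c (act g c) := by
    intro c hc n
    by_contra! hcon
    have hball : ∀ y ∈ classOf E c, HoldsAt Φ n c y := by
      intro y hy
      obtain ⟨g, hg, rfl⟩ := htrans c y ⟨hy, hYa hc, hYa (hEY hy hc)⟩
      exact hcon g hg
    refine hdiam ((hΦ.diam_lt_top_iff _).mpr ⟨n + n, ?_⟩)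
    refine holdsAt_classOf_of_mem_typeClass hκ hM hinv (a := c) (hYa hc).symm ?_
    intro x hx y hy
    have hxX := (hE.mem _ _ hx).2
    have hyX := (hE.mem _ _ hy).2
    exact hΦ.holdsAt_trans hxX (hYX hc) hyX
      (hΦ.holdsAt_symm (hYX hc) hxX (hball x hx)) (hball y hy)
  -- a minimal system of ultrafilters on `Y`
  let := ultrafilterAction Γ σ
  have := continuousConstSMul_ultrafilter Γ (σ := σ)
  obtain ⟨p, hpY, hpcl, hpne, hpmin⟩ := exists_subMulAction_isMinimal (G := Γ)
    {𝒰 : Ultrafilter (Tuple M σ) | Y ∈ 𝒰} (ultrafilter_isClosed_basic Y) ⟨pure a, haY⟩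
    (fun g 𝒰 (h : Y ∈ 𝒰) => (Ultrafilter.mem_map (m := act g.1)).mpr
      (Filter.mem_of_superset h fun y hy => hY_act g.1 g.2 y hy))
  have : CompactSpace p := isCompact_iff_compactSpace.mp hpcl.isCompact
  have : ContinuousConstSMul Γ p :=
    ⟨fun g => ((continuous_const_smul g).comp continuous_subtype_val).subtype_mk _⟩
  obtain ⟨A, hA, hYA⟩ := hYpc
  -- Pseudo-closedness enters here: adding the parameters of `Y` to `B` makes the realisation fall
  -- in `Y`.
  have hreal : ∀ (𝒰 : p) (B : Params M), B.Countable →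
      ∃ y ∈ Y, ∀ D, IsDefinable B D → (y ∈ D ↔ D ∈ 𝒰.1) := by
    intro 𝒰 B hB
    obtain ⟨y, hy⟩ := hM.saturated.exists_realization (mk_index_lt hκ ι)
      (mk_union_lt hκ (mk_lt_of_countable hκ hB) hA) 𝒰.1
    exact ⟨y, hYA.mem_of_realizes hy Set.subset_union_right (hpY 𝒰.2),
      fun D hD => hy D (hD.mono Set.subset_union_left)⟩
  have htp : ∀ (𝒰 : p) (y : Tuple M σ), (∀ D, IsDefinable N D → (y ∈ D ↔ D ∈ 𝒰.1)) →
      tp N y = {φ | {x | Sat x φ} ∈ 𝒰.1} := fun 𝒰 y hy =>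
    Set.ext fun φ => hy _ (isDefinable_setOf_sat φ)
  let r : p → typesOf N Y := fun 𝒰 => ⟨⟨{φ | {x | Sat x φ} ∈ 𝒰.1}, by
    obtain ⟨y, _, hy⟩ := hreal 𝒰 N hN.1
    exact ⟨y, htp 𝒰 y hy⟩⟩, by
    obtain ⟨y, hyY, hy⟩ := hreal 𝒰 N hN.1
    exact ⟨y, hyY, htp 𝒰 y hy⟩⟩
  have hr : Continuous r := by
    refine Continuous.subtype_mk (continuous_generateFrom_iff.mpr ?_) _
    rintro _ ⟨φ, rfl⟩
    exact (ultrafilter_isOpen_basic {x | Sat x φ}).preimage continuous_subtype_val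
  obtain ⟨Z, _, _, f, hf, hfE⟩ := hsm
  have hF : @Measurable _ _ (borel p) (borel Z) (f ∘ r) := by
    have hr' : @Measurable _ _ (borel p) (borel (typesOf N Y)) r := by
      borelize ↥p ↥(typesOf N Y)
      exact hr.measurable
    exact hf.comp hr'
  have hFinv : ∀ (g : Γ) (𝒰 : p), (f ∘ r) (g • 𝒰) = (f ∘ r) 𝒰 := by
    intro g 𝒰
    -- Realising over `g⁻¹ N` as well makes `g c` a realisation of the translated ultrafilter over
    -- `N`.
    obtain ⟨c, hcY, hc⟩ := hreal 𝒰 (N ∪ actParams g.1⁻¹ N)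
      (hN.1.union (countable_actParams hN.1))
    refine (hfE _ _).mp ⟨act g.1 c, c, ?_, ?_, hE.symm _ _ (hE_act g.1 g.2 c hcY)⟩
    · exact htp (g • 𝒰) _ (realizes_map_act (hΓ g.2) Set.subset_union_right hc)
    · exact htp 𝒰 c fun D hD => hc D (hD.mono Set.subset_union_left)
  obtain ⟨𝒰₀, h𝒰₀⟩ := exists_eventually_residual_eq (G := Γ) hF hFinv
  obtain ⟨c, hcY, hc⟩ := hreal 𝒰₀ N hN.1
  -- A generic `𝒱` has the same value as `𝒰₀`, so its realisation over `N` and `c` is equivalent to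
  -- `c` and lies in some ball about `c`.
  obtain ⟨n, hn⟩ : ∃ n, (interior {𝒱 : p | 𝒱.1 ∈ ultrafilterBall Φ n c}).Nonempty := by
    refine exists_interior_nonempty_of_eventually_residual
      (fun n => (isClosed_ultrafilterBall Φ n c).preimage continuous_subtype_val) ?_
    filter_upwards [h𝒰₀] with 𝒱 h𝒱
    obtain ⟨y, hyY, hy⟩ := hreal 𝒱 (N ∪ coords c) (hN.1.union (countable_coords c))
    obtain ⟨x', y', hx', hy', hxy⟩ := (hfE _ _).mpr h𝒱
    have hyx : E y x' := hbdd.rel_of_tp_eq hκ hM hX hE hinv hN (hYX hyY)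
      ((htp 𝒱 y fun D hD => hy D (hD.mono Set.subset_union_left)).trans hx'.symm)
    have hcy : E c y' := hbdd.rel_of_tp_eq hκ hM hX hE hinv hN (hYX hcY)
      ((htp 𝒰₀ c hc).trans hy'.symm)
    have hEcy : E c y := hE.trans _ _ _ hcy (hE.symm _ _ (hE.trans _ _ _ hyx hxy))
    obtain ⟨n, hn⟩ := (hΦ.rel c (hYX hcY) y (hYX hyY)).mp hEcy
    exact ⟨n, (mem_ultrafilterBall_iff Set.subset_union_right hy).mpr hn⟩
  -- By minimality and compactness, finitely many translates of this ball, which are balls about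
  -- translates of `c`, cover the system.
  obtain ⟨I, hI⟩ := isCompact_univ.exists_finite_cover_smul (G := Γ) isOpen_interior hn
  have hcover : ∀ 𝒱 : p, ∃ g ∈ I, 𝒱.1 ∈ ultrafilterBall Φ n (act g.1 c) := by
    intro 𝒱
    obtain ⟨g, hg, 𝒲, h𝒲, rfl⟩ : ∃ g ∈ I,
        𝒱 ∈ (fun x => g • x) '' interior {𝒱 : p | 𝒱.1 ∈ ultrafilterBall Φ n c} := by
      simpa [← Set.image_smul] using hI (Set.mem_univ 𝒱)
    refine ⟨g, hg, ?_⟩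
    obtain ⟨y, hyY, hy⟩ := hreal 𝒲 (coords c ∪ actParams g.1⁻¹ (coords (act g.1 c)))
      ((countable_coords _).union (countable_actParams (countable_coords _)))
    have hcy : HoldsAt Φ n c y :=
      (mem_ultrafilterBall_iff Set.subset_union_left hy).mp
        (interior_subset (s := {𝒱 : p | 𝒱.1 ∈ ultrafilterBall Φ n c}) h𝒲)
    exact (mem_ultrafilterBall_iff subset_rfl
      (realizes_map_act (hΓ g.2) Set.subset_union_right hy)).mpr
      ((holdsAt_act (hΓ g.2) n c y).mpr hcy)
  obtain ⟨l, hl⟩ : ∃ l, ∀ g ∈ I, ∀ h ∈ I, HoldsAt Φ l (act g.1 c) (act h.1 c) := by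
    have hm : ∀ g h : Γ, ∃ m, HoldsAt Φ m (act g.1 c) (act h.1 c) := fun g h =>
      (hΦ.rel _ (hYX (hY_act _ g.2 c hcY)) _ (hYX (hY_act _ h.2 c hcY))).mp
        (hE.trans _ _ _ (hE.symm _ _ (hE_act _ g.2 c hcY)) (hE_act _ h.2 c hcY))
    choose m hm using hm
    refine ⟨I.sup fun g => I.sup fun h => m g h, fun g hg h hh => hΦ.holdsAt_mono ?_ (hm g h)⟩
    exact (Finset.le_sup (f := fun h => m g h) hh).trans
      (Finset.le_sup (f := fun g => I.sup fun h => m g h) hg)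
  obtain ⟨g₀, hg₀, h₀⟩ := hcover 𝒰₀
  have hc'Y : act g₀.1 c ∈ Y := hY_act _ g₀.2 c hcY
  obtain ⟨g, hg, hfar⟩ := hunb _ hc'Y (l + n + n)
  obtain ⟨h, hh, h₁⟩ := hcover ((⟨g, hg⟩ : Γ) • 𝒰₀)
  -- One `y` serves both covers: it is within `n` of `g₀ c`, while `g y` is within `n` of `h c`. The
  -- chain `g₀ c`, `h c`, `g y`, `g g₀ c` has length at most `l + n + n`.
  obtain ⟨y, hyY, hy⟩ := hreal 𝒰₀
    (coords (act g₀.1 c) ∪ actParams g⁻¹ (coords (act h.1 c)))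
    ((countable_coords _).union (countable_actParams (countable_coords _)))
  have hd₁ : HoldsAt Φ n (act g (act g₀.1 c)) (act g y) :=
    (holdsAt_act (hΓ hg) n _ _).mpr ((mem_ultrafilterBall_iff Set.subset_union_left hy).mp h₀)
  have hd₂ : HoldsAt Φ n (act h.1 c) (act g y) :=
    (mem_ultrafilterBall_iff subset_rfl
      (realizes_map_act (hΓ hg) Set.subset_union_right hy)).mp h₁
  have hgy := hYX (hY_act g hg y hyY)
  have hgc := hYX (hY_act g hg _ hc'Y)
  have hhc := hYX (hY_act _ h.2 c hcY)
  exact hfar (hΦ.holdsAt_trans (hYX hc'Y) hgy hgc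
    (hΦ.holdsAt_trans (hYX hc'Y) hhc hgy (hl g₀ hg₀ h hh) hd₂) (hΦ.holdsAt_symm hgc hgy hd₁))

/-- A relation that is type-definable on a complete type is smooth on its saturated subsets. -/
theorem isSmoothOver_of_isTypeDefinable [L.IsCountable] (hκ : Cardinal.continuum.{u} < κ)
    (hM : IsMonster L M κ) (hX : IsTypeDefinable ∅ X) (hE : IsEquivOn X E) (hinv : IsInvariant E)
    (hbdd : IsBounded κ X E) (ha : a ∈ X) (hYa : Y ⊆ typeClass a)
    (hdef : IsTypeDefinable ∅ (graph (restrictTo E (typeClass a)))) (hN : IsCountableModel N) :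
    IsSmoothOver N E Y := by
  classical
  have hYX : Y ⊆ X := fun y hy => hX.mem_of_tp_eq (hYa hy).symm ha
  have hNκ := mk_lt_of_countable hκ hN.1
  -- The trace on `Y` of the saturation of the basic clopen set given by `D`.
  let S : Set (Tuple M σ) → Set (typesOf N Y) := fun D =>
    {p | ∃ x ∈ D, ∃ y, tp N y = p.1.1 ∧ restrictTo E (typeClass a) x y}
  have hS : ∀ D, IsDefinable N D → IsClosed (S D) := by
    intro D hD
    refine isOpen_compl_iff.mp (isOpen_iff_forall_mem_open.mpr fun p hp => ?_)
    obtain ⟨y₀, hy₀Y, hy₀⟩ := p.2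
    -- Compactness: otherwise related pairs with `x ∈ D` and `y` arbitrarily close to the type of
    -- `y₀` have a limit pair, still related by type-definability, placing `p` in `S D`.
    have hex : ∃ D', IsDefinable N D' ∧ y₀ ∈ D' ∧
        ¬ (D' ∩ {y | ∃ x ∈ D, restrictTo E (typeClass a) x y}).Nonempty := by
      by_contra! hcon
      obtain ⟨𝒰, hC, h𝒰⟩ := exists_ultrafilter_tp y₀ _ hcon
      let s : Tuple M σ → Tuple M σ := fun y =>
        if h : ∃ x ∈ D, restrictTo E (typeClass a) x y then h.choose else y
      have hs : ∀ y, (∃ x ∈ D, restrictTo E (typeClass a) x y) →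
          s y ∈ D ∧ restrictTo E (typeClass a) (s y) y := by
        intro y h
        simp only [s, dif_pos h]
        exact h.choose_spec
      obtain ⟨z, hz⟩ := hM.saturated.exists_realization (mk_index_lt hκ _) hNκ
        (𝒰.map fun y => join (s y) y)
      have hzE : z ∈ graph (restrictTo E (typeClass a)) := by
        refine hdef.mem_of_realizes hz (Set.empty_subset _) ?_
        exact Ultrafilter.mem_map.mpr (Filter.mem_of_superset hC fun y hy =>
          join_mem_graph_iff.mpr (hs y hy).2)
      rw [← join_fst_snd z, join_mem_graph_iff] at hzE
      refine hp ⟨fstTuple z, ?_, sndTuple z, ?_, hzE⟩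
      · refine (hz (fstTuple ⁻¹' D) (hD.preimage subset_rfl isTermMap_fst)).mpr ?_
        exact Ultrafilter.mem_map.mpr (Filter.mem_of_superset hC fun y hy => (hs y hy).1)
      · rw [← hy₀]
        exact tp_eq_iff.mpr fun D' hD' =>
          (hz (sndTuple ⁻¹' D') (hD'.preimage subset_rfl isTermMap_snd)).trans (h𝒰 D' hD').symm
    obtain ⟨_, ⟨χ, rfl⟩, hy₀χ, hχ⟩ := hex
    have hopen : IsOpen {q : TypeSpace N σ | χ ∈ q.1} :=
      TopologicalSpace.isOpen_generateFrom_of_mem ⟨χ, rfl⟩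
    refine ⟨Subtype.val ⁻¹' {q : TypeSpace N σ | χ ∈ q.1}, ?_,
      hopen.preimage continuous_subtype_val, ?_⟩
    · rintro q hq ⟨x, hx, y, hy, hxy⟩
      refine hχ ⟨y, ?_, x, hx, hxy⟩
      have : χ ∈ tp N y := hy ▸ hq
      exact this
    · have : χ ∈ tp N y₀ := hy₀χ
      rwa [hy₀] at this
  have : Countable N := hN.1.to_subtype
  have : Countable (ParamFormula N σ) := BFormula.countable _ _
  have : Nonempty (ParamFormula N σ) := ⟨Formula.verum⟩
  obtain ⟨φ, hφ⟩ := exists_surjective_nat (ParamFormula N σ)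
  have : TopologicalSpace.IsCompletelyMetrizableSpace (ℕ → Bool) := inferInstance
  refine ⟨ℕ → Bool, Pi.topologicalSpace, inferInstance,
    fun p n => decide (p ∈ S {x | Sat x (φ n)}), ?_, ?_⟩
  · borelize ↥(typesOf N Y)
    rw [← BorelSpace.measurable_eq (α := ℕ → Bool)]
    refine measurable_pi_iff.mpr fun n => measurable_to_bool ?_
    have : (fun p : typesOf N Y => decide (p ∈ S {x | Sat x (φ n)})) ⁻¹' {true} =
        S {x | Sat x (φ n)} := by
      ext p; simp
    rw [this]
    exact (hS _ (isDefinable_setOf_sat _)).measurableSet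
  · have hcl : ∀ {x y y' : Tuple M σ}, restrictTo E (typeClass a) x y → tp N y = tp N y' →
        restrictTo E (typeClass a) x y' := by
      intro x y y' h hyy'
      exact ⟨hE.trans _ _ _ h.1 (hbdd.rel_of_tp_eq hκ hM hX hE hinv hN (hE.mem _ _ h.1).2 hyy'),
        h.2.1, (tp_eq_mono (Set.empty_subset _) hyy').symm.trans h.2.2⟩
    have hclass : ∀ p : typesOf N Y, ∀ {y}, tp N y = p.1.1 → y ∈ typeClass a := by
      intro p y hy
      obtain ⟨y₀, hy₀Y, hy₀⟩ := p.2
      exact (tp_eq_mono (Set.empty_subset _) (hy.trans hy₀.symm)).trans (hYa hy₀Y)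
    have hmono : ∀ p q : typesOf N Y, inducedRel E N p.1 q.1 → ∀ D, p ∈ S D → q ∈ S D := by
      rintro p q ⟨u, v, hu, hv, huv⟩ D ⟨x, hx, y, hy, hxy⟩
      have hxu := hcl hxy (hy.trans hu.symm)
      exact ⟨x, hx, v, hv, hE.trans _ _ _ hxu.1 huv, hxu.2.1, hclass q hv⟩
    have hsymm : ∀ p q : typesOf N Y, inducedRel E N p.1 q.1 → inducedRel E N q.1 p.1 := by
      rintro p q ⟨u, v, hu, hv, huv⟩
      exact ⟨v, u, hv, hu, hE.symm _ _ huv⟩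
    intro p q
    constructor
    · intro h
      funext n
      exact decide_eq_decide.mpr ⟨hmono p q h _, hmono q p (hsymm p q h) _⟩
    · intro h
      obtain ⟨x, hxY, hx⟩ := p.2
      obtain ⟨y, hyY, hy⟩ := q.2
      -- Equal bits say that every formula in the type of `x` over `N` is satisfied in the class of
      -- `y`; saturation and type-definability realise the whole type there.
      obtain ⟨𝒰, hC, h𝒰⟩ := exists_ultrafilter_tp (A := N) x
        {x' | restrictTo E (typeClass a) x' y} (by
          rintro _ ⟨ψ, rfl⟩ hxψ
          obtain ⟨n, rfl⟩ := hφ ψ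
          have hp : p ∈ S {x | Sat x (φ n)} :=
            ⟨x, hxψ, x, hx, hE.refl x (hYX hxY), hYa hxY, hYa hxY⟩
          obtain ⟨x', hx', y', hy', hxy'⟩ := (decide_eq_decide.mp (congrFun h n)).mp hp
          exact ⟨x', hx', hcl hxy' (hy'.trans hy.symm)⟩)
      obtain ⟨z, hz⟩ := hM.saturated.exists_realization (mk_index_lt hκ ι)
        (mk_lt_of_countable hκ (hN.1.union (countable_coords y))) 𝒰
      refine ⟨z, y, ?_, hy, ?_⟩
      · rw [← hx]
        exact tp_eq_iff.mpr fun D hD => (hz D (hD.mono Set.subset_union_left)).trans (h𝒰 D hD).symm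
      · have hdef' : IsTypeDefinable (coords y) {x' | restrictTo E (typeClass a) x' y} := by
          have := hdef.preimage (Set.empty_subset (coords y))
            (isTermMap_id.join (isTermMap_const subset_rfl))
          convert this using 1
          ext x'
          change restrictTo E (typeClass a) x' y ↔ join x' y ∈ graph _
          exact join_mem_graph_iff.symm
        exact (hdef'.mem_of_realizes hz Set.subset_union_right hC).1

end Smooth

end ManySorted

/-! ### The equivalences. -/

theorem corollary3p5
    {L : ManySorted.SortedLanguage.{u}} [L.IsCountable]
    {M : L.Sorts → Type u} [ManySorted.SortedStructure L M] [Infinite (Σ s : L.Sorts, M s)]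
    (κ : Cardinal.{u}) (hκ : Cardinal.continuum.{u} < κ) (hM : ManySorted.IsMonster L M κ)
    {ι : Type u} [Countable ι] (σ : ι → L.Sorts)
    (X : Set (ManySorted.Tuple M σ)) (hX : ManySorted.IsTypeDefinable ∅ X)
    (E : ManySorted.Tuple M σ → ManySorted.Tuple M σ → Prop)
    (hE : ManySorted.IsEquivOn X E)
    (hinv : ManySorted.IsInvariant E)
    (hbdd : ManySorted.IsBounded κ X E)
    (hFσ : ManySorted.IsFσ E)
    (horb : ManySorted.IsOrbitalOnTypes X E)
    (a : ManySorted.Tuple M σ) (ha : a ∈ X)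
    (Y : Set (ManySorted.Tuple M σ)) (hYa : Y ⊆ ManySorted.typeClass a)
    (hYsat : ManySorted.IsSaturatedFor E Y) (hYpc : ManySorted.IsPseudoClosed κ Y) (haY : a ∈ Y)
    (Φ : ℕ → Set (ManySorted.ParamFormula (∅ : ManySorted.Params M) (Sum.elim σ σ)))
    (hΦ : ManySorted.IsNormalForm X E Φ) :
    List.TFAE
      [ManySorted.IsSmoothOn E Y,
        ∀ N : ManySorted.Params M, ManySorted.IsCountableModel N → ManySorted.IsSmoothOver N E Y,
        ManySorted.IsTypeDefinable ∅
          (ManySorted.graph (ManySorted.restrictTo E (ManySorted.typeClass a))),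
        ∀ b ∈ ManySorted.typeClass a, ManySorted.diam Φ (ManySorted.classOf E b) < ⊤,
        ∀ b ∈ ManySorted.typeClass a, ManySorted.IsPseudoClosed κ (ManySorted.classOf E b),
        ManySorted.diam Φ (ManySorted.classOf E a) < ⊤,
        ManySorted.IsPseudoClosed κ (ManySorted.classOf E a)] := by
  open ManySorted in
  have hE_class : ∀ {x y}, E x y → y ∈ typeClass x := fun {x y} h => horb.1 x y h
  tfae_have 1 → 6 := by
    rintro ⟨N, hN, hsm⟩
    exact hsm.diam_lt_top hκ hM hX hE hinv hbdd horb ha hYa hYsat hYpc haY hΦ hN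
  tfae_have 6 → 4 := by
    intro h b hb
    obtain ⟨n, hn⟩ := (hΦ.diam_lt_top_iff _).mp h
    exact (hΦ.diam_lt_top_iff _).mpr ⟨n, holdsAt_classOf_of_mem_typeClass hκ hM hinv hb hn⟩
  tfae_have 4 → 6 := fun h => h a rfl
  tfae_have 6 → 3 := by
    intro h
    obtain ⟨n, hn⟩ := (hΦ.diam_lt_top_iff _).mp h
    have htp : IsTypeDefinable (∅ : Params M) (typeClass a) := isTypeDefinable_setOf_tp_eq a
    -- By conjugacy one `n` bounds every class in the type of `a`, so `E` coincides there with `Φ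
    -- n`.
    have heq : graph (restrictTo E (typeClass a)) =
        {z | HoldsAt Φ n (fstTuple z) (sndTuple z)} ∩
          (fstTuple ⁻¹' typeClass a ∩ sndTuple ⁻¹' typeClass a) := by
      ext z
      rw [← join_fst_snd z, join_mem_graph_iff]
      constructor
      · rintro ⟨hxy, hx, hy⟩
        exact ⟨holdsAt_classOf_of_mem_typeClass hκ hM hinv hx hn _
          (hE.refl _ (hE.mem _ _ hxy).1) _ hxy, hx, hy⟩
      · rintro ⟨hxy, hx, hy⟩
        exact ⟨(hΦ.rel _ (hX.mem_of_tp_eq hx.symm ha) _ (hX.mem_of_tp_eq hy.symm ha)).mpr ⟨n, hxy⟩,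
          hx, hy⟩
    rw [heq]
    exact (isTypeDefinable_holdsAt n).inter ((htp.preimage subset_rfl isTermMap_fst).inter
      (htp.preimage subset_rfl isTermMap_snd))
  tfae_have 3 → 2 := fun h N hN =>
    isSmoothOver_of_isTypeDefinable hκ hM hX hE hinv hbdd ha hYa h hN
  tfae_have 2 → 1 := by
    intro h
    obtain ⟨N, hN⟩ := exists_isCountableModel (M := M)
    exact ⟨N, hN, h N hN⟩
  tfae_have 3 → 5 := by
    intro h b hb
    refine ⟨coords b, mk_lt_of_countable hκ (countable_coords b), ?_⟩
    have := h.preimage (Set.empty_subset (coords b))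
      ((isTermMap_const subset_rfl).join isTermMap_id)
    convert this using 1
    ext y
    refine Iff.trans ?_ (join_mem_graph_iff (x := b) (y := y)).symm
    exact ⟨fun hy => ⟨hy, hb, (hE_class hy).trans hb⟩, fun hy => hy.1⟩
  tfae_have 5 → 7 := fun h => h a rfl
  tfae_have 7 → 6 := by
    intro h
    obtain ⟨N, hN⟩ := exists_isCountableModel (M := M)
    -- The class takes the role of `Y`; a constant map reduces `E` on it, since it is a single
    -- class.
    refine IsSmoothOver.diam_lt_top (Y := classOf E a) hκ hM hX hE hinv hbdd horb ha
      (fun y hy => hE_class hy) (fun x y hx hxy => hE.trans _ _ _ hx hxy) h (hE.refl a ha) hΦ hN ?_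
    refine ⟨Unit, inferInstance, inferInstance, fun _ => (), ?_, fun p q => ?_⟩
    · exact @measurable_const _ _ (_) (_) _
    · refine iff_of_true ?_ rfl
      obtain ⟨x, hx, hxp⟩ := p.2
      obtain ⟨y, hy, hyq⟩ := q.2
      exact ⟨x, y, hxp, hyq, hE.trans _ _ _ (hE.symm _ _ hx) hy⟩
  tfae_finish
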